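/- We work over $\mathbb{C}$. For an algebraic set $X\subseteq\mathbb{P}^n$, let $\sigma_2(X)$ denote its secant variety, i.e. the closure of $\bigcup_{p_1,p_2\in X}\langle p_1,p_2\rangle$. The slice rank $\mathrm{slrk}(f)$ of a form $f$ of degree $d$ is the least $r$ such that $f=\sum_{i=1}^r \ell_i h_i$ with $\ell_i$ linear forms and $h_i$ forms of degree $d-1$. For a cubic form $f$ in $x_0,\dots,x_4$ let $$\rho_f^{(2)}:\Bigl\{(g_0,\dots,g_4)\;:\; g_i \text{ quadratic forms},\ \sum_{i=0}^4\tfrac{\partial g_i}{\partial x_i}=0\Bigr\}\longrightarrow \mathbb{C}[x_0,\dots,x_4]_4,\qquad (g_i)_i\mapsto\sum_{i=0}^4 g_i\,\frac{\partial f}{\partial x_i}$$ be its second Ruppert map; the minors of size $60$ of $\rho_f^{(2)}$ are polynomials of degree $60$ in the coefficients of $f$. (1) Let $n\ge 4$ and let $C\subset\mathbb{P}^n$ be a smooth irreducible curve that is non-degenerate (not contained in a hyperplane). Then $\sigma_2(C)$ contains no linear subspace $P\subset\mathbb{P}^n$ with $\dim P=2$. (2) Let $C_4\subset\mathbb{P}^4$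 be a rational normal quartic curve, i.e. the image under a linear change of coordinates of $\{(t_0^4:t_0^3t_1:\dots:t_1^4)\}$. Then there is a cubic form $f$, unique up to a nonzero scalar, with $Z(f)=\sigma_2(C_4)$, and it satisfies $\mathrm{slrk}(f)\ge 3$ and $\operatorname{rank}\rho_f^{(2)}\le 59$; equivalently to the latter, all minors of size $60$ of $\rho_f^{(2)}$ vanish. -/

import Mathlib

open MvPolynomial
open scoped LinearAlgebra.Projectivization

noncomputable section

namespace ProjVar

/-! ### Projective space, zero loci, and the Zariski topology -/

/-- Complex projective space `ℙⁿ`: the lines through the origin in `ℂⁿ⁺¹`. -/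
abbrev CP (n : ℕ) : Type := ℙ ℂ (Fin (n + 1) → ℂ)

/-- Polynomials in the homogeneous coordinates `x₀, …, xₙ` of `ℙⁿ`. -/
abbrev CoordRing (n : ℕ) : Type := MvPolynomial (Fin (n + 1)) ℂ

/-- The space `Sᵈ V` of homogeneous polynomials of degree `d` in `x₀, …, xₙ`. -/
abbrev Forms (n d : ℕ) : Submodule ℂ (CoordRing n) := homogeneousSubmodule (Fin (n + 1)) ℂ d

/-- `F` vanishes at the point `p`, that is, on the whole line of `ℂⁿ⁺¹` that `p` represents.
For homogeneous `F` it is enough to test one representative, see `vanishesAt_iff`. -/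
def VanishesAt {n : ℕ} (F : CoordRing n) (p : CP n) : Prop :=
  ∀ v ∈ p.submodule, eval v F = 0

theorem eval_smul_of_isHomogeneous {n d : ℕ} {F : CoordRing n} (hF : F.IsHomogeneous d)
    (a : ℂ) (v : Fin (n + 1) → ℂ) : eval (a • v) F = a ^ d * eval v F := by
  rw [eval_eq, eval_eq, Finset.mul_sum]
  refine Finset.sum_congr rfl fun m hm => ?_
  have hdeg : ∑ i ∈ m.support, m i = d := by
    have h := hF (mem_support_iff.mp hm)
    simpa [Finsupp.weight_apply, Finsupp.sum] using h
  simp only [Pi.smul_apply, smul_eq_mul, mul_pow, Finset.prod_mul_distrib]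
  rw [Finset.prod_pow_eq_pow_sum, hdeg]
  ring

theorem vanishesAt_iff {n d : ℕ} {F : CoordRing n} (hF : F.IsHomogeneous d) (p : CP n) :
    VanishesAt F p ↔ eval p.rep F = 0 := by
  refine ⟨fun h => h _ ?_, fun h v hv => ?_⟩
  · rw [p.submodule_eq]
    exact Submodule.mem_span_singleton_self _
  · rw [p.submodule_eq, Submodule.mem_span_singleton] at hv
    obtain ⟨a, rfl⟩ := hv
    rw [eval_smul_of_isHomogeneous hF, h, mul_zero]

/-- The common zero locus `Z(G) ⊆ ℙⁿ` of a set `G` of polynomials. -/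
def projZeroLocus {n : ℕ} (G : Set (CoordRing n)) : Set (CP n) :=
  {p | ∀ F ∈ G, VanishesAt F p}

/-- The projective algebraic sets: zero loci of sets of homogeneous polynomials. -/
def IsAlgebraicSet {n : ℕ} (X : Set (CP n)) : Prop :=
  ∃ G : Set (CoordRing n), (∀ F ∈ G, ∃ d, F.IsHomogeneous d) ∧ X = projZeroLocus G

/-- The Zariski topology on `ℙⁿ`: the closed sets are exactly the projective algebraic sets. -/
instance zariskiTopology (n : ℕ) : TopologicalSpace (CP n) :=
  TopologicalSpace.ofClosed {X | IsAlgebraicSet X}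
    (by
      refine ⟨{1}, ?_, ?_⟩
      · rintro F rfl
        exact ⟨0, isHomogeneous_one _ _⟩
      · ext p
        simp only [Set.mem_empty_iff_false, projZeroLocus, Set.mem_singleton_iff, forall_eq,
          Set.mem_ofPred_eq, false_iff]
        intro h
        simpa using h 0 (Submodule.zero_mem _))
    (by
      intro A hA
      refine ⟨{F | (∃ d, F.IsHomogeneous d) ∧ ∃ X ∈ A, ∀ p ∈ X, VanishesAt F p},
        fun F hF => hF.1, ?_⟩
      ext p
      constructor
      · rintro hp F ⟨-, X, hX, hF⟩
        exact hF p (hp X hX)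
      · intro hp X hX
        obtain ⟨G, hG, rfl⟩ := hA hX
        exact fun F hF => hp F ⟨hG F hF, _, hX, fun q hq => hq F hF⟩)
    (by
      rintro _ ⟨G, hG, rfl⟩ _ ⟨H, hH, rfl⟩
      refine ⟨{F | ∃ g ∈ G, ∃ h ∈ H, F = g * h}, ?_, ?_⟩
      · rintro _ ⟨g, hg, h, hh, rfl⟩
        obtain ⟨d, hd⟩ := hG g hg
        obtain ⟨e, he⟩ := hH h hh
        exact ⟨d + e, hd.mul he⟩
      · ext p
        constructor
        · rintro (hp | hp) _ ⟨g, hg, h, hh, rfl⟩ v hv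
          · rw [map_mul, hp g hg v hv, zero_mul]
          · rw [map_mul, hp h hh v hv, mul_zero]
        · intro hp
          by_contra hcon
          simp only [Set.mem_union, not_or, projZeroLocus, Set.mem_ofPred_eq, not_forall] at hcon
          obtain ⟨⟨g, hg, hgp⟩, ⟨h, hh, hhp⟩⟩ := hcon
          obtain ⟨d, hd⟩ := hG g hg
          obtain ⟨e, he⟩ := hH h hh
          have hgh := hp _ ⟨g, hg, h, hh, rfl⟩
          rw [vanishesAt_iff (hd.mul he), map_mul, mul_eq_zero] at hgh
          rw [vanishesAt_iff hd] at hgp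
          rw [vanishesAt_iff he] at hhp
          tauto)

theorem isClosed_iff_isAlgebraicSet {n : ℕ} (X : Set (CP n)) :
    IsClosed X ↔ IsAlgebraicSet X := by
  rw [← isOpen_compl_iff]
  change IsAlgebraicSet Xᶜᶜ ↔ _
  rw [compl_compl]

/-- The ideal `I(X)` of all polynomials that vanish on `X`. -/
def idealOf {n : ℕ} (X : Set (CP n)) : Ideal (CoordRing n) where
  carrier := {F | ∀ p ∈ X, VanishesAt F p}
  zero_mem' := fun _ _ _ _ => map_zero _
  add_mem' := fun {a b} ha hb p hp v hv => by
    rw [map_add, ha p hp v hv, hb p hp v hv, add_zero]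
  smul_mem' := fun c F hF p hp v hv => by
    rw [smul_eq_mul, map_mul, hF p hp v hv, mul_zero]

/-! ### Linear spaces and secant varieties -/

/-- The linear subspace of `ℙⁿ` given by a linear subspace `W` of `ℂⁿ⁺¹`; its projective dimension
is `dim W - 1`. -/
def linearSpace {n : ℕ} (W : Submodule ℂ (Fin (n + 1) → ℂ)) : Set (CP n) :=
  {p | p.submodule ≤ W}

/-- The `r`-th secant variety `σ_r(X)`: the Zariski closure of the union of all linear spans
`⟨p₁, …, p_r⟩` of `r` points of `X`. -/
def secantVariety {n : ℕ} (r : ℕ) (X : Set (CP n)) : Set (CP n) :=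
  closure {q | ∃ p : Fin r → CP n, (∀ i, p i ∈ X) ∧ q ∈ linearSpace (⨆ i, (p i).submodule)}

/-! ### Smooth irreducible non-degenerate curves -/

/-- The tangent space at the vector `v` of the affine cone over `X`:
the kernel at `v` of the Jacobian of the ideal of `X`. -/
def coneTangentSpace {n : ℕ} (X : Set (CP n)) (v : Fin (n + 1) → ℂ) :
    Submodule ℂ (Fin (n + 1) → ℂ) where
  carrier := {w | ∀ F ∈ idealOf X, ∑ i, eval v (pderiv i F) * w i = 0}
  zero_mem' := fun F _ => by simp
  add_mem' := fun {a b} ha hb F hF => by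
    simp only [Pi.add_apply, mul_add, Finset.sum_add_distrib, ha F hF, hb F hF, add_zero]
  smul_mem' := fun c w hw F hF => by
    have h : ∀ i, eval v (pderiv i F) * (c • w) i = c * (eval v (pderiv i F) * w i) := fun i => by
      rw [Pi.smul_apply, smul_eq_mul]
      ring
    rw [Finset.sum_congr rfl fun i _ => h i, ← Finset.mul_sum, hw F hF, mul_zero]

/-- A smooth irreducible (closed) curve in `ℙⁿ`. Smoothness is the Jacobian criterion: at every
point, the tangent space of the affine cone has dimension `1 + 1`, i.e. the Jacobian of the
ideal has rank `n - 1`. -/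
structure IsSmoothIrreducibleCurve {n : ℕ} (C : Set (CP n)) : Prop where
  isClosed : IsClosed C
  isIrreducible : IsIrreducible C
  dim_eq_one : topologicalKrullDim C = 1
  smooth : ∀ p ∈ C, Module.finrank ℂ (coneTangentSpace C p.rep) = 2

/-- `X ⊆ ℙⁿ` is non-degenerate: it lies in no proper linear subspace of `ℙⁿ`. -/
def IsNondegenerate {n : ℕ} (X : Set (CP n)) : Prop :=
  ∀ W : Submodule ℂ (Fin (n + 1) → ℂ), X ⊆ linearSpace W → W = ⊤

/-- A rational normal curve in `ℙⁿ`: the image of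
`(t₀ : t₁) ↦ (t₀ⁿ : t₀ⁿ⁻¹ t₁ : ⋯ : t₁ⁿ)` under a linear change of coordinates. -/
def IsRationalNormalCurve {n : ℕ} (C : Set (CP n)) : Prop :=
  ∃ A : (Fin (n + 1) → ℂ) ≃ₗ[ℂ] (Fin (n + 1) → ℂ),
    C = {p | ∃ t : Fin 2 → ℂ, t ≠ 0 ∧
      p.submodule = ℂ ∙ A (fun i => t 0 ^ (n - (i : ℕ)) * t 1 ^ (i : ℕ))}

/-! ### Slice rank and the Ruppert map -/

/-- `f` is a sum of `r` products `ℓ h` with `ℓ` a linear form and `h` a form of degree `d - 1`. -/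
def HasSliceDecomposition {n d : ℕ} (f : Forms n d) (r : ℕ) : Prop :=
  ∃ ℓ h : Fin r → CoordRing n, (∀ i, (ℓ i).IsHomogeneous 1) ∧
    (∀ i, (h i).IsHomogeneous (d - 1)) ∧ (f : CoordRing n) = ∑ i, ℓ i * h i

/-- The slice rank of a form `f` of degree `d ≥ 1`. -/
def sliceRank {n d : ℕ} (f : Forms n d) : ℕ :=
  sInf {r | HasSliceDecomposition f r}

/-- The prolongation `𝔰𝔩⁽ᵉ⁻¹⁾(V) ⊆ V* ⊗ Sᵉ V`: the tensors `∑ ∂ᵢ ⊗ gᵢ`, written as tuples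
`(g₀, …, gₙ)` of forms of degree `e`, with `∑ ∂ᵢ gᵢ = 0`. -/
def prolongation (n e : ℕ) : Submodule ℂ (Fin (n + 1) → CoordRing n) where
  carrier := {g | (∀ i, (g i).IsHomogeneous e) ∧ ∑ i, pderiv i (g i) = 0}
  zero_mem' := ⟨fun _ => isHomogeneous_zero _ _ _, by simp⟩
  add_mem' := fun {a b} ha hb => ⟨fun i => (ha.1 i).add (hb.1 i), by
    simp only [Pi.add_apply, map_add, Finset.sum_add_distrib, ha.2, hb.2, add_zero]⟩
  smul_mem' := fun c g hg => ⟨fun i => (Forms n e).smul_mem c (hg.1 i), by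
    have h : ∀ i, pderiv i ((c • g) i) = c • pderiv i (g i) := fun i => by
      rw [Pi.smul_apply, Derivation.map_smul]
    rw [Finset.sum_congr rfl fun i _ => h i, ← Finset.smul_sum, hg.2, smul_zero]⟩

/-- The `e`-th Ruppert map `ρ_f⁽ᵉ⁾ : 𝔰𝔩⁽ᵉ⁻¹⁾(V) → Sᵉ⁺ᵈ⁻¹ V`, `∑ gᵢ ⊗ ∂ᵢ ↦ ∑ gᵢ ∂ᵢ f`,
of a form `f` of degree `d`. -/
def ruppertMap {n d : ℕ} (e : ℕ) (f : Forms n d) :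
    prolongation n e →ₗ[ℂ] Forms n (e + (d - 1)) where
  toFun g := ⟨∑ i, (g : Fin (n + 1) → CoordRing n) i * pderiv i (f : CoordRing n),
    Submodule.sum_mem _ fun i _ => (g.2.1 i).mul (IsHomogeneous.pderiv f.2)⟩
  map_add' a b := by
    apply Subtype.ext
    simp [add_mul, Finset.sum_add_distrib]
  map_smul' c a := by
    apply Subtype.ext
    simp [Finset.smul_sum]

/-- All minors of size `k` of (the matrix of) a linear map vanish, in every choice of bases. -/
def MinorsVanish {M N : Type} [AddCommGroup M] [Module ℂ M] [AddCommGroup N] [Module ℂ N]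
    (k : ℕ) (φ : M →ₗ[ℂ] N) : Prop :=
  ∀ (ι κ : Type) [Fintype ι] [DecidableEq ι] [Fintype κ] [DecidableEq κ]
    (b : Module.Basis ι ℂ M) (c : Module.Basis κ ℂ N) (rows : Fin k → κ) (cols : Fin k → ι),
    ((LinearMap.toMatrix b c φ).submatrix rows cols).det = 0

end ProjVar

end

open ProjVar

/-!
The first part rests on a dimension count with generic points. Suppose that a plane lies in the
secant variety of `C`, and let `s` be the generic point of the affine cone over the plane; its
coordinates have transcendence degree three over `ℂ` (`not_exists_mem_algCl_pair`). Every secant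
vector is a sum `y + z` of two vectors of the cone over `C`, so `s` is a specialization of such a
sum. Realizing the specialization by a valuation ring (`exists_secant_or_tangent`) shows that,
over some extension field `κ` of `ℂ`, either `s = p + q` with `κ`-points `p`, `q` of the cone, or
`y` and `z` have poles, their leading coefficients cancel, and `s` lies in the tangent space of
the cone at a nonzero `κ`-point `p`. Both cases make the transcendence degree at most two.

* For a secant, two independent linear forms `ℓ₁`, `ℓ₂` vanish on the plane since `n ≥ 4`. From
  `ℓᵢ(p) = -ℓᵢ(q)` the function `ℓ₂/ℓ₁` takes the same value `r` at `p` and `q`. As `C` is a curve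
  contained in no hyperplane, both points, normalized by `ℓ₁`, are algebraic over `ℂ(r)`, so that
  `s` is algebraic over `ℂ(r, ℓ₁(p))` (`exists_mem_algCl_pair_of_secant`). If instead some
  nonzero linear form vanishes on the plane and at `p`, then `p` and `q` are proportional to
  complex points, and the two factors generate a field containing the coordinates of `s`.
* For a tangent, smoothness makes the tangent space two-dimensional and defined over the field of
  the normalized point of tangency, of transcendence degree at most one; one linear form
  vanishing on `s` leaves one parameter (`exists_mem_algCl_pair_of_tangent`).

In the second part `f` is the determinant of the `3 × 3` Hankel matrix of the coordinates. A kernel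
vector of a singular Hankel matrix is a quadratic recurrence for `x₀, …, x₄`, whose characteristic
roots exhibit the point as a combination of two points of the curve or as a limit of such
(`eval_eq_zero_of_eval_hankelCubic`). The cubic is irreducible (`irreducible_hankelCubic`), so by
the Nullstellensatz it is unique up to scalars. Slice rank at most two would let two linear forms
vanish at a point of every tangent line of the curve, which forces their Wronskian along the curve
to vanish and makes them proportional (`hankelCubic_ne_add`). Finally, the cubic is singular along
the curve, so the image of the Ruppert map consists of quartic forms vanishing on the curve. Quartic
forms have dimension `70` and their restrictions to the curve have dimension at least `16`, which
bounds the rank by `54`.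
-/

open ProjVar

/-! ### Algebraic dependence over `ℂ` -/

/-- The relative algebraic closure of `ℂ(S)` in an extension field `κ` of `ℂ`. -/
noncomputable def algCl {κ : Type} [Field κ] [Algebra ℂ κ] (S : Set κ) : IntermediateField ℂ κ :=
  (algebraicClosure (IntermediateField.adjoin ℂ S) κ).restrictScalars ℂ

section AlgCl

variable {κ : Type} [Field κ] [Algebra ℂ κ]

/-- `algCl` is the closure operator of the algebraic matroid, which gives access to the exchange
property and to ranks. -/
theorem mem_algCl_iff_mem_closure {S : Set κ} {x : κ} :
    x ∈ algCl S ↔ x ∈ (AlgebraicIndependent.matroid ℂ κ).closure S := by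
  rw [AlgebraicIndependent.matroid_closure_eq]
  simp only [algCl, IntermediateField.mem_restrictScalars, mem_algebraicClosure_iff,
    IntermediateField.isAlgebraic_adjoin_iff, SetLike.mem_coe, Subalgebra.mem_algebraicClosure]

theorem subset_algCl (S : Set κ) : S ⊆ algCl S := fun x hx =>
  mem_algCl_iff_mem_closure.2 (Matroid.mem_closure_of_mem _ hx (by simp))

theorem algCl_le_algCl {S T : Set κ} (h : S ⊆ algCl T) : algCl S ≤ algCl T := by
  have h' : S ⊆ (AlgebraicIndependent.matroid ℂ κ).closure T := fun x hx =>
    mem_algCl_iff_mem_closure.1 (h hx)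
  intro x hx
  rw [mem_algCl_iff_mem_closure] at hx ⊢
  exact Matroid.closure_subset_closure_of_subset_closure h' hx

theorem mem_algCl_exchange {x t : κ} (hx : x ∈ algCl {t}) (hx' : x ∉ algCl (∅ : Set κ)) :
    t ∈ algCl {x} := by
  rw [mem_algCl_iff_mem_closure] at hx hx' ⊢
  have := Matroid.mem_closure_insert hx' (f := t) (by simpa using hx)
  simpa using this

/-- As `ℂ` is algebraically closed, only the constants are algebraic over it. -/
theorem exists_of_mem_algCl_empty {x : κ} (hx : x ∈ algCl (∅ : Set κ)) :
    ∃ a : ℂ, algebraMap ℂ κ a = x := by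
  have hx' : IsAlgebraic ℂ x := by
    rw [algCl, IntermediateField.mem_restrictScalars, mem_algebraicClosure_iff,
      IntermediateField.isAlgebraic_adjoin_iff, Algebra.adjoin_empty] at hx
    obtain ⟨P, hP, hPx⟩ := hx
    have hsurj : Function.Surjective (algebraMap ℂ (⊥ : Subalgebra ℂ κ)) :=
      fun ⟨y, hy⟩ => by
        obtain ⟨a, rfl⟩ := Algebra.mem_bot.1 hy
        exact ⟨a, rfl⟩
    obtain ⟨Q, rfl⟩ := Polynomial.map_surjective _ hsurj P
    refine ⟨Q, ?_, ?_⟩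
    · rintro rfl
      simp at hP
    · rwa [Polynomial.aeval_map_algebraMap] at hPx
  exact minpoly.mem_range_of_degree_eq_one ℂ x
    (IsAlgClosed.degree_eq_one_of_irreducible ℂ (minpoly.irreducible hx'.isIntegral))

/-- A field of transcendence degree at most two has no three algebraically independent elements. -/
theorem not_algebraicIndependent_of_mem_algCl_pair {a b : κ} {u : Fin 3 → κ}
    (hu : ∀ i, u i ∈ algCl {a, b}) : ¬ AlgebraicIndependent ℂ u := by
  intro h
  have hI : (AlgebraicIndependent.matroid ℂ κ).Indep (Set.range u) := h.coe_range
  have h1 := hI.encard_le_eRk_of_subset (X := (AlgebraicIndependent.matroid ℂ κ).closure {a, b})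
    (by rintro _ ⟨i, rfl⟩; exact mem_algCl_iff_mem_closure.1 (hu i))
  rw [Matroid.eRk_closure_eq] at h1
  have h2 := h1.trans ((Matroid.eRk_le_encard _ _).trans (Set.encard_insert_le {b} a))
  rw [← Set.image_univ, h.injective.encard_image, Set.encard_univ] at h2
  rw [Set.encard_singleton] at h2
  norm_num at h2

end AlgCl

/-! ### Points of the affine cone with coordinates in a ring -/

/-- An `R`-valued point of the affine zero locus of the ideal `I`. -/
def IsConePoint {n : ℕ} (I : Ideal (CoordRing n)) {R : Type} [CommRing R] [Algebra ℂ R]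
    (p : Fin (n + 1) → R) : Prop :=
  ∀ F ∈ I, aeval p F = 0

section ConePoint

variable {n : ℕ} {R : Type} [CommRing R] [Algebra ℂ R]

theorem aeval_smul_of_isHomogeneous {d : ℕ} {F : CoordRing n} (hF : F.IsHomogeneous d)
    (c : R) (p : Fin (n + 1) → R) : aeval (c • p) F = c ^ d * aeval p F := by
  simp only [aeval_def, eval₂_eq, Finset.mul_sum]
  refine Finset.sum_congr rfl fun m hm => ?_
  have hdeg : ∑ i ∈ m.support, m i = d := by
    have h := hF (mem_support_iff.mp hm)
    simpa [Finsupp.weight_apply, Finsupp.sum] using h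
  simp only [Pi.smul_apply, smul_eq_mul, mul_pow, Finset.prod_mul_distrib]
  rw [Finset.prod_pow_eq_pow_sum, hdeg]
  ring

theorem aeval_eq_sum_homogeneousComponent (F : CoordRing n) (p : Fin (n + 1) → R) :
    aeval p F = ∑ d ∈ Finset.range (F.totalDegree + 1), aeval p (homogeneousComponent d F) := by
  conv_lhs => rw [← sum_homogeneousComponent F]
  rw [map_sum]

/-- A polynomial vanishing on a complex line through the origin does so componentwise. -/
theorem eval_homogeneousComponent_eq_zero {F : CoordRing n} {v : Fin (n + 1) → ℂ}
    (h : ∀ c : ℂ, eval (c • v) F = 0) (d : ℕ) : eval v (homogeneousComponent d F) = 0 := by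
  classical
  set Q : Polynomial ℂ := ∑ e ∈ Finset.range (F.totalDegree + 1),
    Polynomial.monomial e (eval v (homogeneousComponent e F)) with hQ
  have hQ0 : Q = 0 := by
    refine Polynomial.funext fun c => ?_
    have h1 := h c
    change aeval _ F = 0 at h1
    rw [aeval_eq_sum_homogeneousComponent] at h1
    rw [hQ, Polynomial.eval_finsetSum, Polynomial.eval_zero, ← h1]
    refine Finset.sum_congr rfl fun e _ => ?_
    rw [aeval_smul_of_isHomogeneous (homogeneousComponent_isHomogeneous e F),
      Polynomial.eval_monomial, mul_comm]
    rfl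
  by_cases hd : d < F.totalDegree + 1
  · have h2 := congrArg (fun P => Polynomial.coeff P d) hQ0
    simpa [hQ, Polynomial.finsetSum_coeff, Polynomial.coeff_monomial, hd] using h2
  · rw [homogeneousComponent_eq_zero _ _ (by omega), map_zero]

theorem homogeneousComponent_mem_idealOf {X : Set (CP n)} {F : CoordRing n} (hF : F ∈ idealOf X)
    (d : ℕ) : homogeneousComponent d F ∈ idealOf X := fun p hp _ hv =>
  eval_homogeneousComponent_eq_zero (fun c => hF p hp _ (p.submodule.smul_mem c hv)) d

theorem IsConePoint.smul {X : Set (CP n)} {p : Fin (n + 1) → R} (hp : IsConePoint (idealOf X) p)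
    (c : R) : IsConePoint (idealOf X) (c • p) := by
  intro F hF
  rw [aeval_eq_sum_homogeneousComponent]
  refine Finset.sum_eq_zero fun d _ => ?_
  rw [aeval_smul_of_isHomogeneous (homogeneousComponent_isHomogeneous d F),
    hp _ (homogeneousComponent_mem_idealOf hF d), mul_zero]

theorem IsConePoint.map {I : Ideal (CoordRing n)} {S : Type} [CommRing S] [Algebra ℂ S]
    {p : Fin (n + 1) → R} (hp : IsConePoint I p) (φ : R →ₐ[ℂ] S) :
    IsConePoint I (fun i => φ (p i)) := fun F hF => by
  rw [← MvPolynomial.comp_aeval_apply, hp F hF, map_zero]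

theorem IsConePoint.of_map {I : Ideal (CoordRing n)} {S : Type} [CommRing S] [Algebra ℂ S]
    {p : Fin (n + 1) → R} (φ : R →ₐ[ℂ] S) (hφ : Function.Injective φ)
    (hp : IsConePoint I (fun i => φ (p i))) : IsConePoint I p := fun F hF => by
  refine hφ ?_
  rw [MvPolynomial.comp_aeval_apply, hp F hF, map_zero]

/-- The differential of `F` at `p`, applied to the vector `w`. -/
noncomputable def gradDot (F : CoordRing n) (p w : Fin (n + 1) → R) : R :=
  ∑ i, aeval p (pderiv i F) * w i

theorem gradDot_eq_sum (F : CoordRing n) (p w : Fin (n + 1) → R) : gradDot F p w =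
    ∑ d ∈ Finset.range (F.totalDegree + 1), gradDot (homogeneousComponent d F) p w := by
  simp only [gradDot]
  rw [Finset.sum_comm]
  refine Finset.sum_congr rfl fun i _ => ?_
  rw [← Finset.sum_mul, ← map_sum, ← map_sum, sum_homogeneousComponent]

/-- Euler's relation: the vector `p` itself is tangent to the cone at `p`. -/
theorem IsConePoint.gradDot_self {X : Set (CP n)} {p : Fin (n + 1) → R}
    (hp : IsConePoint (idealOf X) p) {F : CoordRing n} (hF : F ∈ idealOf X) :
    gradDot F p p = 0 := by
  have key : ∀ d, gradDot (homogeneousComponent d F) p p = 0 := fun d => by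
    have h := congrArg (aeval p) (homogeneousComponent_isHomogeneous d F).sum_X_mul_pderiv
    rw [map_nsmul, hp _ (homogeneousComponent_mem_idealOf hF d), map_sum, nsmul_zero] at h
    rw [gradDot, ← h]
    exact Finset.sum_congr rfl fun i _ => by rw [map_mul, aeval_X, mul_comm]
  rw [gradDot_eq_sum]
  exact Finset.sum_eq_zero fun d _ => key d

/-- Being tangent to the cone is unaffected by scaling the point of tangency. -/
theorem gradDot_smul_eq_zero {X : Set (CP n)} {p w : Fin (n + 1) → R}
    (h : ∀ F ∈ idealOf X, gradDot F p w = 0) (c : R) {F : CoordRing n} (hF : F ∈ idealOf X) :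
    gradDot F (c • p) w = 0 := by
  have key : ∀ d, gradDot (homogeneousComponent d F) (c • p) w = 0 := fun d => by
    have h1 := h _ (homogeneousComponent_mem_idealOf hF d)
    have h2 : ∀ i, aeval (c • p) (pderiv i (homogeneousComponent d F)) * w i =
        c ^ (d - 1) * (aeval p (pderiv i (homogeneousComponent d F)) * w i) := fun i => by
      rw [aeval_smul_of_isHomogeneous (homogeneousComponent_isHomogeneous d F).pderiv, mul_assoc]
    rw [gradDot, Finset.sum_congr rfl fun i _ => h2 i, ← Finset.mul_sum, ← gradDot, h1, mul_zero]
  rw [gradDot_eq_sum]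
  exact Finset.sum_eq_zero fun d _ => key d

/-- First-order Taylor expansion of a polynomial along a direction `w`. -/
theorem exists_aeval_add_smul (F : CoordRing n) (p w : Fin (n + 1) → R) (ε : R) :
    ∃ r : R, aeval (p + ε • w) F = aeval p F + ε * gradDot F p w + ε ^ 2 * r := by
  induction F using MvPolynomial.induction_on with
  | C a => exact ⟨0, by simp [gradDot]⟩
  | add F G hF hG =>
    obtain ⟨r, hr⟩ := hF
    obtain ⟨s, hs⟩ := hG
    refine ⟨r + s, ?_⟩
    rw [map_add, hr, hs, map_add]
    simp only [gradDot, map_add, add_mul, Finset.sum_add_distrib]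
    ring
  | mul_X F i hF =>
    obtain ⟨r, hr⟩ := hF
    have hg : gradDot (F * X i) p w = gradDot F p w * p i + aeval p F * w i := by
      simp only [gradDot, Derivation.leibniz, pderiv_X, smul_eq_mul, map_add, map_mul, aeval_X,
        add_mul, Finset.sum_add_distrib, Finset.sum_mul]
      rw [add_comm]
      congr 1
      · exact Finset.sum_congr rfl fun j _ => by ring
      · rw [Finset.sum_eq_single i]
        · simp
        · intro j _ hj
          simp [hj.symm]
        · simp
    refine ⟨r * p i + gradDot F p w * w i + ε * r * w i, ?_⟩
    rw [map_mul, hr, map_mul, aeval_X, aeval_X, hg]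
    simp only [Pi.add_apply, Pi.smul_apply, smul_eq_mul]
    ring

end ConePoint

/-! ### The Zariski topology of projective space -/

section Zariski

variable {n : ℕ}

theorem vanishesAt_mk_iff {d : ℕ} {F : CoordRing n} (hF : F.IsHomogeneous d)
    {v : Fin (n + 1) → ℂ} (hv : v ≠ 0) :
    VanishesAt F (Projectivization.mk ℂ v hv) ↔ eval v F = 0 := by
  refine ⟨fun h => h v ?_, fun h w hw => ?_⟩
  · rw [Projectivization.submodule_mk]
    exact Submodule.mem_span_singleton_self v
  · rw [Projectivization.submodule_mk, Submodule.mem_span_singleton] at hw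
    obtain ⟨a, rfl⟩ := hw
    rw [eval_smul_of_isHomogeneous hF, h, mul_zero]

theorem mk_mem_of_isConePoint {X : Set (CP n)} (hX : IsClosed X) {v : Fin (n + 1) → ℂ}
    (hv : v ≠ 0) (h : IsConePoint (idealOf X) v) : Projectivization.mk ℂ v hv ∈ X := by
  obtain ⟨G, hG, rfl⟩ := (isClosed_iff_isAlgebraicSet X).1 hX
  intro F hF
  obtain ⟨d, hd⟩ := hG F hF
  rw [vanishesAt_mk_iff hd]
  exact h F fun p hp => hp F hF

theorem isConePoint_of_mem {X : Set (CP n)} {p : CP n} (hp : p ∈ X) {v : Fin (n + 1) → ℂ}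
    (hv : v ∈ p.submodule) : IsConePoint (idealOf X) v := fun F hF => by
  change eval _ F = 0
  exact hF p hp v hv

theorem isClosed_setOf_vanishesAt (F : CoordRing n) : IsClosed {p : CP n | VanishesAt F p} := by
  rw [isClosed_iff_isAlgebraicSet]
  refine ⟨Set.range fun d => homogeneousComponent d F, ?_, ?_⟩
  · rintro _ ⟨d, rfl⟩
    exact ⟨d, homogeneousComponent_isHomogeneous d F⟩
  · ext p
    constructor
    · rintro hp _ ⟨d, rfl⟩ v hv
      exact eval_homogeneousComponent_eq_zero (fun c => hp _ (p.submodule.smul_mem c hv)) d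
    · intro hp v hv
      rw [← sum_homogeneousComponent F, map_sum]
      exact Finset.sum_eq_zero fun d _ => hp _ ⟨d, rfl⟩ v hv

/-- The linear form with coefficient vector `a`. -/
noncomputable def linForm (a : Fin (n + 1) → ℂ) : CoordRing n := ∑ i, C (a i) * X i

theorem linForm_isHomogeneous (a : Fin (n + 1) → ℂ) : (linForm a).IsHomogeneous 1 :=
  IsHomogeneous.sum _ _ _ fun i _ => by
    simpa using (isHomogeneous_C _ (a i)).mul (isHomogeneous_X ℂ i)

theorem aeval_linForm {R : Type} [CommRing R] [Algebra ℂ R] (a : Fin (n + 1) → ℂ)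
    (p : Fin (n + 1) → R) : aeval p (linForm a) = ∑ i, algebraMap ℂ R (a i) * p i := by
  simp [linForm]

theorem eval_linForm (a v : Fin (n + 1) → ℂ) : eval v (linForm a) = a ⬝ᵥ v := by
  simp [linForm, dotProduct]

theorem exists_dotProduct_of_notMem {W : Submodule ℂ (Fin (n + 1) → ℂ)} {v : Fin (n + 1) → ℂ}
    (hv : v ∉ W) : ∃ a : Fin (n + 1) → ℂ, (∀ w ∈ W, a ⬝ᵥ w = 0) ∧ a ⬝ᵥ v ≠ 0 := by
  obtain ⟨φ, hφv, hφ⟩ := Submodule.exists_le_ker_of_notMem hv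
  have key : ∀ w, (fun i => φ (Pi.single i 1)) ⬝ᵥ w = φ w := fun w => by
    conv_rhs => rw [pi_eq_sum_univ' w]
    simp [dotProduct, map_sum, mul_comm]
  exact ⟨_, fun w hw => (key w).trans (hφ hw), by rwa [key]⟩

theorem isClosed_linearSpace (W : Submodule ℂ (Fin (n + 1) → ℂ)) :
    IsClosed (linearSpace W : Set (CP n)) := by
  have : (linearSpace W : Set (CP n)) =
      ⋂ a ∈ {a : Fin (n + 1) → ℂ | ∀ w ∈ W, a ⬝ᵥ w = 0}, {p | VanishesAt (linForm a) p} := by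
    ext p
    simp only [Set.mem_iInter]
    constructor
    · intro hp a ha v hv
      rw [eval_linForm]
      exact ha v (hp hv)
    · intro hp v hv
      by_contra hvW
      obtain ⟨a, ha, hav⟩ := exists_dotProduct_of_notMem hvW
      exact hav (by simpa only [eval_linForm] using hp a ha v hv)
  rw [this]
  exact isClosed_biInter fun a _ => isClosed_setOf_vanishesAt _

/-- Points of projective space are linear spaces, hence closed. -/
instance : T1Space (CP n) where
  t1 p := by
    have : ({p} : Set (CP n)) = linearSpace p.submodule := by
      ext q
      simp only [Set.mem_singleton_iff, linearSpace, Set.mem_ofPred_eq]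
      refine ⟨fun h => h ▸ le_rfl, fun h => ?_⟩
      refine Projectivization.submodule_injective
        (Submodule.eq_of_le_of_finrank_eq h ?_)
      rw [Projectivization.finrank_submodule, Projectivization.finrank_submodule]
    rw [this]
    exact isClosed_linearSpace _

theorem projZeroLocus_idealOf {X : Set (CP n)} (hX : IsClosed X) :
    {p | ∀ F ∈ idealOf X, VanishesAt F p} = X := by
  refine Set.Subset.antisymm (fun p hp => ?_) fun p hp F hF => hF p hp
  rw [← p.mk_rep]
  refine mk_mem_of_isConePoint hX p.rep_nonzero fun F hF => ?_
  change eval _ F = 0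
  refine hp F hF _ ?_
  rw [p.submodule_eq]
  exact Submodule.mem_span_singleton_self _

/-- Closed sets are determined by their ideals in a Noetherian ring. -/
instance : TopologicalSpace.NoetherianSpace (CP n) := by
  refine StrictMono.wellFoundedGT (β := Ideal (CoordRing n))
    (f := fun U : TopologicalSpace.Opens (CP n) => idealOf (U : Set (CP n))ᶜ) ?_
  refine Monotone.strictMono_of_injective ?_ ?_
  · exact fun U V h F hF p hp => hF p fun hpU => hp (h hpU)
  · intro U V h
    have h' : idealOf (U : Set (CP n))ᶜ = idealOf (V : Set (CP n))ᶜ := h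
    have hU := projZeroLocus_idealOf (X := (U : Set (CP n))ᶜ) U.isOpen.isClosed_compl
    rw [h', projZeroLocus_idealOf V.isOpen.isClosed_compl] at hU
    exact TopologicalSpace.Opens.ext (compl_injective hU.symm)

end Zariski

/-! ### Proper closed subsets of a curve -/

section Curve

variable {n : ℕ} {C : Set (CP n)}

/-- A closed subset of a curve other than the curve itself is finite: an irreducible component
`Z` with two points would give a chain `{a} ⊂ Z ⊂ C`. -/
theorem finite_of_isClosed_of_ssubset (hCc : IsClosed C) (hCi : IsIrreducible C)
    (hCd : topologicalKrullDim C = 1) {Y : Set (CP n)} (hY : IsClosed Y) (hYC : Y ⊆ C)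
    (hne : Y ≠ C) : Y.Finite := by
  obtain ⟨S, hSf, hS, hYS⟩ :=
    TopologicalSpace.NoetherianSpace.exists_finite_set_closeds_irreducible
      (⟨Y, hY⟩ : TopologicalSpace.Closeds (CP n))
  have hYS' : Y = ⋃ Z ∈ S, (Z : Set (CP n)) := by
    have h := congrArg (fun Z : TopologicalSpace.Closeds (CP n) => (Z : Set (CP n))) hYS
    lift S to Finset (TopologicalSpace.Closeds (CP n)) using hSf
    rw [← Finset.sup_id_eq_sSup] at h
    simpa [TopologicalSpace.Closeds.coe_finset_sup, Finset.sup_set_eq_biUnion] using h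
  rw [hYS']
  refine hSf.biUnion fun Z hZ => ?_
  have hZY : (Z : Set (CP n)) ⊆ Y := by
    rw [hYS']
    exact Set.subset_biUnion_of_mem (u := fun Z : TopologicalSpace.Closeds (CP n) =>
      (Z : Set (CP n))) hZ
  refine Set.Subsingleton.finite fun a ha b hb => ?_
  by_contra hab
  have hirr : ∀ T : Set (CP n), T ⊆ C → IsIrreducible T →
      IsIrreducible ((↑) ⁻¹' T : Set C) := by
    intro T hT hTi
    refine ⟨?_, ?_⟩
    · obtain ⟨x, hx⟩ := hTi.nonempty
      exact ⟨⟨x, hT hx⟩, hx⟩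
    · rintro _ _ ⟨u, hu, rfl⟩ ⟨v, hv, rfl⟩ ⟨x, hx, hxu⟩ ⟨y, hy, hyv⟩
      obtain ⟨z, hz, hzu, hzv⟩ := hTi.2 u v hu hv ⟨x, hx, hxu⟩ ⟨y, hy, hyv⟩
      exact ⟨⟨z, hT hz⟩, hz, hzu, hzv⟩
  let mk : ∀ T : Set (CP n), T ⊆ C → IsIrreducible T → IsClosed T →
      TopologicalSpace.IrreducibleCloseds C := fun T h1 h2 h3 =>
    ⟨(↑) ⁻¹' T, hirr T h1 h2, h3.preimage continuous_subtype_val⟩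
  have hlt : ∀ T U (h1 : T ⊆ C) (h2 : IsIrreducible T) (h3 : IsClosed T) (k1 : U ⊆ C)
      (k2 : IsIrreducible U) (k3 : IsClosed U), T ⊆ U → T ≠ U →
      mk T h1 h2 h3 < mk U k1 k2 k3 := by
    intro T U h1 h2 h3 k1 k2 k3 hTU hTU'
    refine lt_of_le_of_ne (fun x hx => hTU hx) fun h => hTU' (hTU.antisymm fun x hx => ?_)
    have : (⟨x, k1 hx⟩ : C) ∈ (mk T h1 h2 h3 : Set C) := by
      rw [h]
      exact hx
    exact this
  have haC : ({a} : Set (CP n)) ⊆ C := Set.singleton_subset_iff.2 (hYC (hZY ha))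
  have h1 := hlt {a} Z haC isIrreducible_singleton isClosed_singleton (hZY.trans hYC) (hS Z hZ)
    Z.isClosed (Set.singleton_subset_iff.2 ha)
    (fun h => hab ((h.symm ▸ hb : b ∈ ({a} : Set (CP n))).symm))
  have h2 := hlt Z C (hZY.trans hYC) (hS Z hZ) Z.isClosed subset_rfl hCi hCc (hZY.trans hYC)
    (fun h => hne (hYC.antisymm (h ▸ hZY)))
  have h3 : ((2 : ℕ) : WithBot ℕ∞) ≤ topologicalKrullDim C := by
    refine Order.LTSeries.length_le_krullDim (α := TopologicalSpace.IrreducibleCloseds C)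
      (RelSeries.fromListIsChain [_, _, _] (by simp)
        (List.isChain_cons_cons.2 ⟨h1, List.isChain_cons_cons.2 ⟨h2, by simp⟩⟩))
  rw [hCd] at h3
  norm_num at h3

end Curve

/-! ### Points of a curve with coordinates in an extension field -/

section Points

variable {n : ℕ} {C : Set (CP n)} {κ : Type} [Field κ] [Algebra ℂ κ]

/-- A proper ideal of a complex polynomial ring has a common zero. -/
theorem exists_isConePoint_of_ne_top {J : Ideal (CoordRing n)} (hJ : J ≠ ⊤) :
    ∃ v : Fin (n + 1) → ℂ, IsConePoint J v := by
  obtain ⟨M, hM, hJM⟩ := Ideal.exists_le_maximal J hJ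
  obtain ⟨v, hv⟩ := eq_vanishingIdeal_singleton_of_isMaximal ℂ hM
  refine ⟨v, fun F hF => ?_⟩
  have := hJM hF
  rw [hv] at this
  exact this v rfl

/-- The Nullstellensatz, tested at points over an extension field. -/
theorem aeval_eq_zero_of_forall_isConePoint {J : Ideal (CoordRing n)} {G : CoordRing n}
    (hG : ∀ v : Fin (n + 1) → ℂ, IsConePoint J v → eval v G = 0) {p : Fin (n + 1) → κ}
    (hp : IsConePoint J p) : aeval p G = 0 := by
  have : G ∈ vanishingIdeal ℂ (zeroLocus ℂ J) := fun v hv => hG v hv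
  rw [vanishingIdeal_zeroLocus_eq_radical] at this
  obtain ⟨N, hN⟩ := this
  have h := hp _ hN
  rw [map_pow] at h
  exact (pow_eq_zero_iff (fun h0 => by simp [h0] at h)).1 h

/-- If finitely many closed points exhaust the common zeros of `J`, then every point of the zero
locus over an extension field is proportional to one of them. -/
theorem exists_eq_smul_of_finite {J : Ideal (CoordRing n)} {Y : Set (CP n)} (hY : Y.Finite)
    (hJ : ∀ (v : Fin (n + 1) → ℂ) (hv : v ≠ 0), IsConePoint J v → Projectivization.mk ℂ v hv ∈ Y)
    {p : Fin (n + 1) → κ} (hp0 : p ≠ 0) (hp : IsConePoint J p) :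
    ∃ (c : κ) (v : Fin (n + 1) → ℂ), ∀ i, p i = c * algebraMap ℂ κ (v i) := by
  by_cases hprop : ∃ y : CP n, ∀ a b,
      algebraMap ℂ κ (y.rep a) * p b = algebraMap ℂ κ (y.rep b) * p a
  · obtain ⟨y, hy⟩ := hprop
    obtain ⟨a, ha⟩ := Function.ne_iff.1 y.rep_nonzero
    have ha' : algebraMap ℂ κ (y.rep a) ≠ 0 := by simpa using ha
    refine ⟨p a / algebraMap ℂ κ (y.rep a), y.rep, fun b => ?_⟩
    rw [div_mul_eq_mul_div, eq_div_iff ha']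
    linear_combination hy a b
  · push Not at hprop
    choose a b hab using hprop
    obtain ⟨i, hi⟩ := Function.ne_iff.1 hp0
    exfalso
    have h := aeval_eq_zero_of_forall_isConePoint (J := J)
      (G := X i * ∏ y ∈ hY.toFinset, (C (y.rep (a y)) * X (b y) - C (y.rep (b y)) * X (a y)))
      (fun v hv => ?_) hp
    · rw [map_mul, aeval_X, map_prod, mul_eq_zero, Finset.prod_eq_zero_iff] at h
      rcases h with h | ⟨y, -, h⟩
      · exact hi h
      · apply hab y
        simpa [sub_eq_zero] using h
    · by_cases hv0 : v = 0
      · simp [hv0]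
      · have hy := hJ v hv0 hv
        rw [map_mul, map_prod]
        refine mul_eq_zero_of_right _ (Finset.prod_eq_zero (hY.mem_toFinset.2 hy) ?_)
        have hmem : v ∈ ℂ ∙ (Projectivization.mk ℂ v hv0).rep := by
          rw [← Projectivization.submodule_eq, Projectivization.submodule_mk]
          exact Submodule.mem_span_singleton_self v
        obtain ⟨t, ht⟩ := Submodule.mem_span_singleton.1 hmem
        have ht' : ∀ i, v i = t * (Projectivization.mk ℂ v hv0).rep i := fun i =>
          (congrFun ht i).symm
        rw [map_sub, map_mul, map_mul, eval_C, eval_X, eval_C, eval_X, ht' (a _), ht' (b _)]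
        ring

/-- Only finitely many points of a curve lie on a hypersurface not containing it. -/
theorem finite_inter_vanishesAt (hC : IsSmoothIrreducibleCurve C) {h : CoordRing n}
    (hI : h ∉ idealOf C) : (C ∩ {p | VanishesAt h p}).Finite := by
  refine finite_of_isClosed_of_ssubset hC.isClosed hC.isIrreducible hC.dim_eq_one
    (hC.isClosed.inter (isClosed_setOf_vanishesAt h)) Set.inter_subset_left fun h' => hI ?_
  intro p hp
  rw [← h'] at hp
  exact hp.2

/-- A point of the curve over an extension field that lies on a hypersurface not containing the
curve is proportional to a complex point. -/
theorem exists_eq_smul_of_aeval_eq_zero (hC : IsSmoothIrreducibleCurve C) {h : CoordRing n}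
    {d : ℕ} (hh : h.IsHomogeneous d) (hI : h ∉ idealOf C) {p : Fin (n + 1) → κ} (hp0 : p ≠ 0)
    (hp : IsConePoint (idealOf C) p) (hph : aeval p h = 0) :
    ∃ (c : κ) (v : Fin (n + 1) → ℂ), ∀ i, p i = c * algebraMap ℂ κ (v i) := by
  refine exists_eq_smul_of_finite (J := idealOf C ⊔ Ideal.span {h})
    (finite_inter_vanishesAt hC hI) (fun v hv hvJ => ⟨?_, ?_⟩) hp0 ?_
  · exact mk_mem_of_isConePoint hC.isClosed hv fun F hF => hvJ F (Ideal.mem_sup_left hF)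
  · exact (vanishesAt_mk_iff hh hv).2
      (hvJ h (Ideal.mem_sup_right (Ideal.mem_span_singleton_self h)))
  · intro F hF
    have hle : idealOf C ⊔ Ideal.span {h} ≤ RingHom.ker (aeval (R := ℂ) p) :=
      sup_le (fun G hG => hp G hG) ((Ideal.span_singleton_le_iff_mem _).2 hph)
    exact hle hF

/-- If `x` is algebraic over the image of a polynomial ring, then it is algebraic over the
variables. -/
theorem mem_algCl_of_isIntegralElem {s : ℕ} {S : Set κ} (g : MvPolynomial (Fin s) ℂ →ₐ[ℂ] κ)
    (hg : ∀ i, g (X i) ∈ algCl S) {x : κ} (hx : g.toRingHom.IsIntegralElem x) : x ∈ algCl S := by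
  have hrange : ∀ P, g P ∈ algCl S := fun P => by
    induction P using MvPolynomial.induction_on with
    | C a => simp
    | add P Q hP hQ => simpa using (algCl S).add_mem hP hQ
    | mul_X P i hP => simpa using (algCl S).mul_mem hP (hg i)
  obtain ⟨P, hPm, hP⟩ := hx
  have hint : IsIntegral (algebraicClosure (IntermediateField.adjoin ℂ S) κ) x := by
    let g' : MvPolynomial (Fin s) ℂ →+* algebraicClosure (IntermediateField.adjoin ℂ S) κ :=
      RingHom.codRestrict g.toRingHom _ hrange
    refine ⟨P.map g', hPm.map g', ?_⟩
    rw [Polynomial.eval₂_map]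
    exact hP
  have := (hint.isAlgebraic).restrictScalars (IntermediateField.adjoin ℂ S)
  exact mem_algebraicClosure_iff.2 this

/-- The normalized coordinates of a point of a curve generate an extension of transcendence degree
at most one. Otherwise Noether normalization produces infinitely many complex points of the curve
on a hypersurface that does not contain it. -/
theorem exists_forall_mem_algCl_singleton (hC : IsSmoothIrreducibleCurve C)
    {p : Fin (n + 1) → κ} (hp : IsConePoint (idealOf C) p) {a : Fin (n + 1) → ℂ}
    (ha : aeval p (linForm a) = 1) : ∃ t : κ, ∀ j, p j ∈ algCl {t} := by
  set R := (aeval (R := ℂ) p).range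
  set π : CoordRing n →ₐ[ℂ] R := (aeval (R := ℂ) p).rangeRestrict with hπ
  have hπs : Function.Surjective π := AlgHom.rangeRestrict_surjective _
  have : Algebra.FiniteType ℂ R := Algebra.FiniteType.of_surjective π hπs
  obtain ⟨s, g, hginj, hgint⟩ := exists_integral_inj_algHom_of_fg ℂ R
  rcases Nat.lt_or_ge s 2 with hs | hs
  · obtain ⟨t, ht⟩ : ∃ t : κ, ∀ i, (g (X i) : κ) ∈ algCl {t} := by
      interval_cases s
      · exact ⟨0, fun i => i.elim0⟩
      · refine ⟨g (X 0), fun i => ?_⟩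
        rw [Subsingleton.elim i 0]
        exact subset_algCl _ rfl
    refine ⟨t, fun j => mem_algCl_of_isIntegralElem (R.val.comp g) ht ?_⟩
    obtain ⟨P, hPm, hP⟩ := hgint (π (X j))
    refine ⟨P, hPm, ?_⟩
    have h := congrArg R.val hP
    rw [map_zero] at h
    have h2 := Polynomial.hom_eval₂ P g.toRingHom (R.val : R →+* κ) (π (X j))
    have h3 : (R.val : R →+* κ) (π (X j)) = p j := by simp [hπ]
    rw [h3] at h2
    exact h2.symm.trans h
  · exfalso
    let i₀ : Fin s := ⟨0, by omega⟩
    let i₁ : Fin s := ⟨1, by omega⟩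
    have hi : i₀ ≠ i₁ := by simp [i₀, i₁]
    obtain ⟨γ₀, hγ₀⟩ := hπs (g (X i₀))
    obtain ⟨γ₁, hγ₁⟩ := hπs (g (X i₁))
    -- two algebraically independent elements: the ideal `(X₀, X₁ - b, X₂, …)` lies under a prime of
    -- `R`, and a closed point of that prime is a point of the curve with `γ₀ = 0` and `γ₁ = b`
    have hpts : ∀ b : ℂ, ∃ v : Fin (n + 1) → ℂ, IsConePoint (idealOf C) v ∧
        eval v (linForm a) = 1 ∧ eval v γ₀ = 0 ∧ eval v γ₁ = b := by
      intro b
      let φ : MvPolynomial (Fin s) ℂ →ₐ[ℂ] ℂ := aeval (Pi.single i₁ b)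
      have hφ : (RingHom.ker φ).IsPrime := RingHom.ker_isPrime _
      obtain ⟨⟨Q, hQp⟩, hQ⟩ := RingHom.IsIntegral.comap_surjective hgint hginj ⟨RingHom.ker φ, hφ⟩
      have hQ' : ∀ P, g P ∈ Q ↔ φ P = 0 := fun P => by
        have h := congrArg (fun Z => P ∈ PrimeSpectrum.asIdeal Z) hQ
        simpa [PrimeSpectrum.comap_asIdeal, RingHom.mem_ker] using h
      obtain ⟨v, hv⟩ := exists_isConePoint_of_ne_top (J := Ideal.comap π Q)
        (Ideal.comap_ne_top _ hQp.ne_top)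
      have hker : ∀ F, aeval p F = 0 → eval v F = 0 := fun F hF => by
        refine hv F ?_
        have h0 : π F = 0 := Subtype.ext hF
        rw [Ideal.mem_comap, h0]
        exact Q.zero_mem
      refine ⟨v, fun F hF => hker F (hp F hF), ?_, ?_, ?_⟩
      · have h := hker (linForm a - 1) (by rw [map_sub, ha, map_one, sub_self])
        rwa [map_sub, map_one, sub_eq_zero] at h
      · refine hv γ₀ ?_
        rw [Ideal.mem_comap, hγ₀, hQ']
        simp [φ, hi]
      · have h : eval v (γ₁ - MvPolynomial.C b) = 0 := by
          refine hv (γ₁ - MvPolynomial.C b) ?_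
          have h1 : π (MvPolynomial.C b) = g (MvPolynomial.C b) := by
            rw [← algebraMap_eq, ← algebraMap_eq, AlgHom.commutes, AlgHom.commutes]
          rw [Ideal.mem_comap, map_sub, hγ₁, h1, ← map_sub, hQ']
          simp [φ]
        rwa [map_sub, eval_C, sub_eq_zero] at h
    choose v hvC hva hv0 hv1 using hpts
    have hvne : ∀ b, v b ≠ 0 := fun b h => by
      have := hva b
      rw [h, eval_linForm, dotProduct_zero] at this
      exact zero_ne_one this
    -- the homogenization of `γ₀` with respect to the linear form `a`
    set N := γ₀.totalDegree with hN
    set Γ : CoordRing n :=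
      ∑ d ∈ Finset.range (N + 1), linForm a ^ (N - d) * homogeneousComponent d γ₀ with hΓ
    have hΓh : Γ.IsHomogeneous N := by
      refine IsHomogeneous.sum _ _ _ fun d hd => ?_
      have h := ((linForm_isHomogeneous a).pow (N - d)).mul (homogeneousComponent_isHomogeneous d γ₀)
      rwa [one_mul, Nat.sub_add_cancel (Nat.lt_succ_iff.1 (Finset.mem_range.1 hd))] at h
    have hΓe : ∀ {S : Type} [CommRing S] [Algebra ℂ S] (q : Fin (n + 1) → S),
        aeval q (linForm a) = 1 → aeval q Γ = aeval q γ₀ := fun q hq => by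
      rw [aeval_eq_sum_homogeneousComponent γ₀, hΓ, map_sum]
      refine Finset.sum_congr rfl fun d _ => ?_
      rw [map_mul, map_pow, hq, one_pow, one_mul]
    have hΓI : Γ ∉ idealOf C := fun h => by
      have h1 := (hΓe p ha).symm.trans (hp Γ h)
      have h2 : g (X i₀) = 0 := hγ₀.symm.trans (Subtype.ext h1)
      exact X_ne_zero (R := ℂ) i₀ (hginj (h2.trans (map_zero g).symm))
    have hinj : Function.Injective fun b => Projectivization.mk ℂ (v b) (hvne b) := by
      intro b c hbc
      obtain ⟨t, ht⟩ := (Projectivization.mk_eq_mk_iff' ℂ _ _ _ _).1 hbc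
      have h1 := hva b
      rw [← ht, eval_smul_of_isHomogeneous (linForm_isHomogeneous a), hva c, pow_one,
        mul_one] at h1
      rw [h1, one_smul] at ht
      rw [← hv1 b, ← hv1 c, ht]
    refine Set.infinite_of_injective_forall_mem hinj (fun b => ?_) (finite_inter_vanishesAt hC hΓI)
    exact ⟨mk_mem_of_isConePoint hC.isClosed _ (hvC b),
      (vanishesAt_mk_iff hΓh _).2 ((hΓe (v b) (hva b)).trans (hv0 b))⟩

end Points

/-! ### The Jacobian criterion over extension fields -/

section Jacobian

/-- The Jacobian matrix of `F₁, …, Fₘ`, completed to a square matrix by two constant rows. -/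
noncomputable def jacMatrix {m : ℕ} (e₀ e₁ : Fin (m + 2) → ℂ) (F : Fin m → CoordRing (m + 1)) :
    Matrix (Fin (m + 2)) (Fin (m + 2)) (CoordRing (m + 1)) :=
  Matrix.of (Fin.cons (fun j => C (e₀ j)) (Fin.cons (fun j => C (e₁ j))
    (fun i j => pderiv j (F i))))

theorem coneTangentSpace_smul {n : ℕ} {X : Set (CP n)} {v w : Fin (n + 1) → ℂ} (t : ℂ)
    (hw : w ∈ coneTangentSpace X v) : w ∈ coneTangentSpace X (t • v) :=
  fun _ hF => gradDot_smul_eq_zero hw t hF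

/-- If the tangent space has dimension two, then the gradients of the ideal of `X` span a space of
codimension at most two: `m` independent gradients are completed to a basis. -/
theorem exists_det_jacMatrix_ne_zero_of_finrank {m : ℕ} {X : Set (CP (m + 1))}
    {v : Fin (m + 2) → ℂ} (hv : Module.finrank ℂ (coneTangentSpace X v) = 2) :
    ∃ e₀ e₁ F, (∀ i, F i ∈ idealOf X) ∧ eval v (jacMatrix (m := m) e₀ e₁ F).det ≠ 0 := by
  set grads : Set (Fin (m + 2) → ℂ) :=
    {g | ∃ F ∈ idealOf X, g = fun j => eval v (pderiv j F)} with hgrads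
  obtain ⟨r, f, hf, hfs, hfi⟩ : ∃ (r : ℕ) (f : Fin r → Fin (m + 2) → ℂ), (∀ i, f i ∈ grads) ∧
      Submodule.span ℂ (Set.range f) = Submodule.span ℂ grads ∧ LinearIndependent ℂ f :=
    ⟨_, Submodule.exists_fun_fin_finrank_span_eq ℂ grads⟩
  have hr : m ≤ r := by
    let L : (Fin (m + 2) → ℂ) →ₗ[ℂ] (Fin r → ℂ) := Matrix.mulVecLin (Matrix.of f)
    have hker : LinearMap.ker L ≤ coneTangentSpace X v := by
      intro w hw F hF
      have hspan : ∀ g ∈ Submodule.span ℂ (Set.range f), g ⬝ᵥ w = 0 := by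
        intro g hg
        induction hg using Submodule.span_induction with
        | mem g hg =>
          obtain ⟨i, rfl⟩ := hg
          exact congrFun (LinearMap.mem_ker.1 hw) i
        | zero => exact zero_dotProduct w
        | add g h _ _ hg hh => rw [add_dotProduct, hg, hh, add_zero]
        | smul c g _ hg => rw [smul_dotProduct, hg, smul_zero]
      exact hspan (fun j => eval v (pderiv j F)) (hfs ▸ Submodule.subset_span ⟨F, hF, rfl⟩)
    have h1 := (Submodule.finrank_mono hker).trans hv.le
    have h2 := L.finrank_range_add_finrank_ker
    have h3 := Submodule.finrank_le (LinearMap.range L)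
    simp only [Module.finrank_fin_fun] at h2 h3
    omega
  have hlt : ∀ {k : ℕ} (u : Fin k → Fin (m + 2) → ℂ), k < m + 2 →
      ∃ e, e ∉ Submodule.span ℂ (Set.range u) := fun {k} u hk => by
    by_contra! h
    have h1 : Submodule.span ℂ (Set.range u) = ⊤ := eq_top_iff.2 fun x _ => h x
    have h2 := finrank_range_le_card (R := ℂ) u
    rw [Set.finrank, h1, finrank_top, Module.finrank_fin_fun, Fintype.card_fin] at h2
    omega
  set u : Fin m → Fin (m + 2) → ℂ := fun i => f (Fin.castLE hr i)
  have hu : LinearIndependent ℂ u := hfi.comp _ (Fin.castLE_injective hr)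
  obtain ⟨e₁, he₁⟩ := hlt u (by omega)
  have hu₁ := hu.finCons he₁
  obtain ⟨e₀, he₀⟩ := hlt (Fin.cons e₁ u : Fin (m + 1) → Fin (m + 2) → ℂ) (by omega)
  have hu₀ := hu₁.finCons he₀
  choose F hF hFu using fun i => hf (Fin.castLE hr i)
  refine ⟨e₀, e₁, F, hF, ?_⟩
  rw [RingHom.map_det, ← isUnit_iff_ne_zero, ← Matrix.isUnit_iff_isUnit_det,
    ← Matrix.linearIndependent_rows_iff_isUnit]
  suffices h : ((eval v).mapMatrix (jacMatrix e₀ e₁ F)).row = Fin.cons e₀ (Fin.cons e₁ u) from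
    h ▸ hu₀
  funext i j
  refine Fin.cases ?_ (fun i => Fin.cases ?_ (fun i => ?_) i) i
  · simp [jacMatrix, Matrix.row]
  · simp [jacMatrix, Matrix.row]
  · simp [jacMatrix, Matrix.row, u, hFu]

/-- The Jacobian of a smooth curve has corank two at points over extension fields as well. -/
theorem exists_aeval_det_jacMatrix_ne_zero {m : ℕ} {C : Set (CP (m + 1))}
    (hC : IsSmoothIrreducibleCurve C) {κ : Type} [Field κ] [Algebra ℂ κ] {p : Fin (m + 2) → κ}
    (hp0 : p ≠ 0) (hp : IsConePoint (idealOf C) p) :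
    ∃ e₀ e₁ F, (∀ i, F i ∈ idealOf C) ∧ aeval p (jacMatrix (m := m) e₀ e₁ F).det ≠ 0 := by
  by_contra! hdet
  refine hp0 (funext fun i => ?_)
  -- by smoothness, the ideal of `C` and all these determinants have no common zero but the origin
  set D : Set (CoordRing (m + 1)) :=
    {G | ∃ e₀ e₁ F, (∀ i, F i ∈ idealOf C) ∧ G = (jacMatrix (m := m) e₀ e₁ F).det} with hD
  have h := aeval_eq_zero_of_forall_isConePoint (J := idealOf C ⊔ Ideal.span D) (G := X i)
    (fun v hv => ?_) (p := p) ?_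
  · simpa using h
  · by_cases hv0 : v = 0
    · simp [hv0]
    exfalso
    set y := Projectivization.mk ℂ v hv0 with hy
    have hyC : y ∈ C :=
      mk_mem_of_isConePoint hC.isClosed hv0 fun F hF => hv F (Ideal.mem_sup_left hF)
    obtain ⟨t, ht⟩ := Projectivization.exists_smul_eq_mk_rep ℂ v hv0
    have hT : coneTangentSpace C v = coneTangentSpace C y.rep := by
      ext w
      constructor
      · intro hw
        rw [hy, ← ht]
        exact coneTangentSpace_smul (t : ℂ) hw
      · intro hw
        rw [hy, ← ht] at hw
        have := coneTangentSpace_smul ((t⁻¹ : ℂˣ) : ℂ) hw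
        rwa [← Units.smul_def, inv_smul_smul] at this
    obtain ⟨e₀, e₁, F, hF, hne⟩ :=
      exists_det_jacMatrix_ne_zero_of_finrank (hT ▸ hC.smooth y hyC)
    exact hne (hv _ (Ideal.mem_sup_right (Ideal.subset_span ⟨e₀, e₁, F, hF, rfl⟩)))
  · have hle : idealOf C ⊔ Ideal.span D ≤ RingHom.ker (aeval (R := ℂ) p) := by
      refine sup_le (fun G hG => hp G hG) (Ideal.span_le.2 ?_)
      rintro _ ⟨e₀, e₁, F, hF, rfl⟩
      exact hdet e₀ e₁ F hF
    exact fun F hF => hle hF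

end Jacobian

/-! ### Specialization of secant lines along a valuation -/

section Specialization

variable {n : ℕ}

theorem gradDot_map {R S : Type} [CommRing R] [Algebra ℂ R] [CommRing S] [Algebra ℂ S]
    (φ : R →ₐ[ℂ] S) (F : CoordRing n) (p w : Fin (n + 1) → R) :
    gradDot F (fun i => φ (p i)) (fun i => φ (w i)) = φ (gradDot F p w) := by
  simp only [gradDot, map_sum, map_mul, MvPolynomial.comp_aeval_apply]

/-- A prime of the coordinate ring that contains the kernel of evaluation at an `L`-valued point
is the center of a valuation ring of `L`. -/
theorem exists_valuationSubring {L : Type} [Field L] [Algebra ℂ L] (θ : CoordRing n →ₐ[ℂ] L)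
    (P : Ideal (CoordRing n)) [P.IsPrime] (hP : ∀ G, θ G = 0 → G ∈ P) :
    ∃ O : ValuationSubring L, (∀ G, θ G ∈ O) ∧ ∀ G, O.valuation (θ G) < 1 ↔ G ∈ P := by
  set π : CoordRing n →+* θ.toRingHom.range := θ.toRingHom.rangeRestrict with hπ
  have hπs : Function.Surjective π := RingHom.rangeRestrict_surjective _
  have hker : RingHom.ker π ≤ P := fun G hG => hP G (congrArg Subtype.val hG)
  have : (P.map π).IsPrime := Ideal.map_isPrime_of_surjective hπs hker
  have hmem : ∀ G, π G ∈ P.map π ↔ G ∈ P := fun G => by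
    rw [← Ideal.mem_comap, Ideal.comap_map_of_surjective π hπs, ← RingHom.ker_eq_comap_bot,
      sup_eq_left.2 hker]
  set A := LocalSubring.ofPrime θ.toRingHom.range (P.map π) with hA
  obtain ⟨O, hO, hloc⟩ := A.exists_le_valuationSubring
  have hle : ∀ G, θ G ∈ A.toSubring := fun G => LocalSubring.le_ofPrime _ _ ⟨G, rfl⟩
  refine ⟨O, fun G => hO (hle G), fun G => ?_⟩
  have h1 : O.valuation (θ G) < 1 ↔ (⟨θ G, hO (hle G)⟩ : O) ∈ IsLocalRing.maximalIdeal O :=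
    (O.valuation_lt_one_iff ⟨θ G, hO (hle G)⟩).symm
  have h2 : algebraMap θ.toRingHom.range A.toSubring (π G) ∈ IsLocalRing.maximalIdeal _ ↔ G ∈ P :=
    (IsLocalization.AtPrime.to_map_mem_maximal_iff _ (P.map π) (π G)).trans (hmem G)
  rw [h1, ← h2, IsLocalRing.mem_maximalIdeal, IsLocalRing.mem_maximalIdeal, mem_nonunits_iff,
    mem_nonunits_iff, not_iff_not]
  exact isUnit_map_iff (Subring.inclusion hO) (⟨θ G, hle G⟩ : A.toSubring)

/-- Let `y`, `z` be points of the cone over `X` with coordinates in a field `L`, and let `P` be a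
prime to which the kernel of evaluation at `y + z` specializes. Then the generic point `s` of `P`
lies on a secant or on a tangent of the cone. Choose a valuation ring with center `P`. If `y` is
integral, then so is `z`, and both can be reduced. Otherwise let `c` be the coordinate of `y` with
the worst pole; then `c⁻¹ y` and `-c⁻¹ z` reduce to the same point, and the linear term of the
Taylor expansion shows that `s` is tangent there. -/
theorem exists_secant_or_tangent_of_field {X : Set (CP n)} {L : Type} [Field L] [Algebra ℂ L]
    {y z : Fin (n + 1) → L} (hy : IsConePoint (idealOf X) y) (hz : IsConePoint (idealOf X) z)
    (P : Ideal (CoordRing n)) [P.IsPrime] (hP : ∀ G, aeval (y + z) G = 0 → G ∈ P) :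
    ∃ (κ : Type) (_ : Field κ) (_ : Algebra ℂ κ) (s : Fin (n + 1) → κ),
      (∀ G, aeval s G = 0 ↔ G ∈ P) ∧
      ((∃ p q : Fin (n + 1) → κ, IsConePoint (idealOf X) p ∧ IsConePoint (idealOf X) q ∧
          s = p + q) ∨
        ∃ p : Fin (n + 1) → κ, p ≠ 0 ∧ IsConePoint (idealOf X) p ∧
          ∀ F ∈ idealOf X, gradDot F p s = 0) := by
  obtain ⟨O, hO, hval⟩ := exists_valuationSubring (aeval (R := ℂ) (y + z)) P hP
  let θ : CoordRing n →+* O := RingHom.codRestrict (aeval (R := ℂ) (y + z)).toRingHom O hO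
  let _ : Algebra ℂ O := (θ.comp MvPolynomial.C).toAlgebra
  let φ : O →ₐ[ℂ] L :=
    { O.subtype with
      commutes' := fun a => by
        change aeval (y + z) (MvPolynomial.C a) = _
        rw [aeval_C] }
  have hφ : Function.Injective φ := Subtype.val_injective
  let res : O →ₐ[ℂ] IsLocalRing.ResidueField O :=
    { IsLocalRing.residue O with commutes' := fun a => rfl }
  have hres : ∀ x : O, res x = 0 ↔ O.valuation (x : L) < 1 := fun x => by
    rw [← O.valuation_lt_one_iff]
    exact IsLocalRing.residue_eq_zero_iff x
  set sO : Fin (n + 1) → O := fun i => θ (MvPolynomial.X i) with hsO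
  have hφs : ∀ i, φ (sO i) = y i + z i := fun i => by
    change aeval (y + z) (MvPolynomial.X i) = _
    rw [aeval_X]
    rfl
  have hθ : ∀ G, φ (aeval sO G) = aeval (y + z) G := fun G => by
    rw [MvPolynomial.comp_aeval_apply]
    exact congrArg (fun f => aeval f G) (funext hφs)
  refine ⟨IsLocalRing.ResidueField O, inferInstance, inferInstance, fun i => res (sO i),
    fun G => ?_, ?_⟩
  · rw [← MvPolynomial.comp_aeval_apply, hres, ← hval, ← hθ]
    rfl
  by_cases hint : ∀ i, y i ∈ O
  · left
    set yO : Fin (n + 1) → O := fun i => ⟨y i, hint i⟩ with hyO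
    have hyc : IsConePoint (idealOf X) yO := IsConePoint.of_map φ hφ hy
    have hzc : IsConePoint (idealOf X) (sO - yO) := by
      refine IsConePoint.of_map φ hφ ?_
      convert hz using 2 with i
      rw [Pi.sub_apply, map_sub, hφs]
      exact add_sub_cancel_left _ _
    refine ⟨_, _, hyc.map res, hzc.map res, funext fun i => ?_⟩
    simp
  · right
    push Not at hint
    obtain ⟨j, hj⟩ := hint
    obtain ⟨i, hi⟩ := Finite.exists_max fun i => O.valuation (y i)
    have hc1 : 1 < O.valuation (y i) := by
      refine lt_of_lt_of_le ?_ (hi j)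
      rwa [← not_le, O.valuation_le_one_iff]
    have hc0 : y i ≠ 0 := fun h => by simp [h] at hc1
    have hv0 : 0 < O.valuation (y i) := zero_lt_one.trans hc1
    have hyle : ∀ k, y k / y i ∈ O := fun k => by
      rw [← O.valuation_le_one_iff, map_div₀]
      exact div_le_one_of_le₀ (hi k) hv0.le
    have hεlt : O.valuation (y i)⁻¹ < 1 := by
      rw [map_inv₀]
      exact inv_lt_one_of_one_lt₀ hc1
    set ε : O := ⟨(y i)⁻¹, (O.valuation_le_one_iff _).1 hεlt.le⟩ with hε
    have hε0 : ε ≠ 0 := fun h => inv_ne_zero hc0 (congrArg Subtype.val h)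
    have hεr : res ε = 0 := (hres ε).2 hεlt
    set yO : Fin (n + 1) → O := fun k => ⟨y k / y i, hyle k⟩ with hyO
    have hyc : IsConePoint (idealOf X) yO := by
      refine IsConePoint.of_map φ hφ ?_
      convert hy.smul (y i)⁻¹ using 2 with k
      exact div_eq_inv_mul _ _
    set zO : Fin (n + 1) → O := yO - ε • sO with hzO
    have hzc : IsConePoint (idealOf X) zO := by
      refine IsConePoint.of_map φ hφ ?_
      convert hz.smul (-(y i)⁻¹) using 2 with k
      have h1 : φ (yO k) = y k / y i := rfl
      have h2 : φ ε = (y i)⁻¹ := rfl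
      rw [hzO, Pi.sub_apply, Pi.smul_apply, smul_eq_mul, map_sub, map_mul, hφs, h1, h2,
        Pi.smul_apply, smul_eq_mul]
      field_simp
      ring
    refine ⟨fun k => res (zO k), fun h => ?_, hzc.map res, fun F hF => ?_⟩
    · have h1 := congrFun h i
      have h2 : yO i = 1 := Subtype.ext (div_self hc0)
      simp [hzO, h2, hεr] at h1
    · obtain ⟨r, hr⟩ := exists_aeval_add_smul F zO sO ε
      rw [hzO, sub_add_cancel, hyc F hF, ← hzO, hzc F hF, zero_add] at hr
      have h1 : ε * (gradDot F zO sO + ε * r) = 0 := by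
        rw [hr]
        ring
      have h2 := (mul_eq_zero.1 h1).resolve_left hε0
      have h3 := congrArg res h2
      rw [map_add, map_mul, hεr, zero_mul, add_zero, map_zero] at h3
      rw [gradDot_map, h3]

/-- The same for points with coordinates in a ring `B`: some prime `Q` of `B` avoids the values
at `y + z` of the polynomials outside `P`, and the points can be taken over `Frac (B / Q)`. -/
theorem exists_secant_or_tangent {X : Set (CP n)} {B : Type} [CommRing B] [Algebra ℂ B]
    {y z : Fin (n + 1) → B} (hy : IsConePoint (idealOf X) y) (hz : IsConePoint (idealOf X) z)
    (P : Ideal (CoordRing n)) [P.IsPrime] (hP : ∀ G, aeval (y + z) G = 0 → G ∈ P) :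
    ∃ (κ : Type) (_ : Field κ) (_ : Algebra ℂ κ) (s : Fin (n + 1) → κ),
      (∀ G, aeval s G = 0 ↔ G ∈ P) ∧
      ((∃ p q : Fin (n + 1) → κ, IsConePoint (idealOf X) p ∧ IsConePoint (idealOf X) q ∧
          s = p + q) ∨
        ∃ p : Fin (n + 1) → κ, p ≠ 0 ∧ IsConePoint (idealOf X) p ∧
          ∀ F ∈ idealOf X, gradDot F p s = 0) := by
  obtain ⟨Q, hQ, -, hdisj⟩ := Ideal.exists_le_prime_disjoint (⊥ : Ideal B)
    (P.primeCompl.map (aeval (R := ℂ) (y + z))) (by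
      rw [Set.disjoint_left]
      rintro _ h0 ⟨G, hG, rfl⟩
      exact hG (hP G h0))
  let φ : B →ₐ[ℂ] FractionRing (B ⧸ Q) :=
    (IsScalarTower.toAlgHom ℂ (B ⧸ Q) (FractionRing (B ⧸ Q))).comp (Ideal.Quotient.mkₐ ℂ Q)
  refine exists_secant_or_tangent_of_field (hy.map φ) (hz.map φ) P fun G hG => ?_
  by_contra hGP
  refine Set.disjoint_left.1 hdisj ?_ ⟨G, hGP, rfl⟩
  have h1 : (fun i => φ (y i)) + (fun i => φ (z i)) = fun i => φ ((y + z) i) := by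
    funext i
    simp
  rw [h1, ← MvPolynomial.comp_aeval_apply] at hG
  have h2 : Ideal.Quotient.mk Q (aeval (y + z) G) = 0 :=
    (IsFractionRing.injective (B ⧸ Q) (FractionRing (B ⧸ Q))) (hG.trans (map_zero _).symm)
  exact Ideal.Quotient.eq_zero_iff_mem.1 h2

/-- A polynomial that vanishes at all sums of two vectors of the cone over `X` vanishes on the
secant variety. -/
theorem vanishesAt_of_mem_secantVariety {X : Set (CP n)} {G : CoordRing n}
    (hG : ∀ v w : Fin (n + 1) → ℂ, IsConePoint (idealOf X) v → IsConePoint (idealOf X) w →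
      eval (v + w) G = 0) {p : CP n} (hp : p ∈ secantVariety 2 X) : VanishesAt G p := by
  refine closure_minimal (s := {q | ∃ p : Fin 2 → CP n, (∀ i, p i ∈ X) ∧
    q ∈ linearSpace (⨆ i, (p i).submodule)}) ?_ (isClosed_setOf_vanishesAt G) hp
  rintro q ⟨p, hpX, hq⟩ u hu
  have h1 := hq hu
  have h2 : ⨆ i, (p i).submodule ≤ (p 0).submodule ⊔ (p 1).submodule :=
    iSup_le (Fin.forall_fin_two.2 ⟨le_sup_left, le_sup_right⟩)
  obtain ⟨v, hv, w, hw, rfl⟩ := Submodule.mem_sup.1 (h2 h1)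
  exact hG v w (isConePoint_of_mem (hpX 0) hv) (isConePoint_of_mem (hpX 1) hw)

end Specialization

/-! ### Transcendence degrees of points on secants and tangents -/

section Count

variable {n : ℕ} {C : Set (CP n)} {κ : Type} [Field κ] [Algebra ℂ κ]

theorem aeval_mem_of_forall_mem {E : IntermediateField ℂ κ} {p : Fin (n + 1) → κ}
    (hp : ∀ i, p i ∈ E) (F : CoordRing n) : aeval p F ∈ E := by
  induction F using MvPolynomial.induction_on with
  | C a => simp
  | add P Q hP hQ => simpa using E.add_mem hP hQ
  | mul_X P i hP => simpa using E.mul_mem hP (hp i)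

theorem eq_zero_of_linForm_mem (hnd : IsNondegenerate C) {a : Fin (n + 1) → ℂ}
    (ha : linForm a ∈ idealOf C) : a = 0 := by
  have h := hnd (LinearMap.ker (dotProductBilin ℂ ℂ a)) fun p hp v hv => by
    have := ha p hp v hv
    rw [eval_linForm] at this
    exact this
  funext i
  have h1 : (Pi.single i 1 : Fin (n + 1) → ℂ) ∈ LinearMap.ker (dotProductBilin ℂ ℂ a) := by
    rw [h]
    trivial
  simpa [dotProductBilin] using h1

/-- If a point of the curve lies on a hyperplane, then it is proportional to a complex point. -/
theorem exists_eq_smul_of_linForm_eq_zero (hC : IsSmoothIrreducibleCurve C)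
    (hnd : IsNondegenerate C) {p : Fin (n + 1) → κ} (hp0 : p ≠ 0)
    (hp : IsConePoint (idealOf C) p) {a : Fin (n + 1) → ℂ} (ha0 : a ≠ 0)
    (ha : aeval p (linForm a) = 0) :
    ∃ (c : κ) (v : Fin (n + 1) → ℂ), ∀ i, p i = c * algebraMap ℂ κ (v i) :=
  exists_eq_smul_of_aeval_eq_zero hC (linForm_isHomogeneous a)
    (fun h => ha0 (eq_zero_of_linForm_mem hnd h)) hp0 hp ha

theorem linForm_add (a b : Fin (n + 1) → ℂ) : linForm (a + b) = linForm a + linForm b := by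
  simp [linForm, add_mul, Finset.sum_add_distrib]

theorem linForm_smul (c : ℂ) (a : Fin (n + 1) → ℂ) :
    linForm (c • a) = MvPolynomial.C c * linForm a := by
  simp [linForm, Finset.mul_sum, mul_assoc]

theorem linForm_single (i : Fin (n + 1)) : linForm (Pi.single i 1 : Fin (n + 1) → ℂ) = X i := by
  rw [linForm, Finset.sum_eq_single i]
  · simp
  · intro j _ hj
    simp [hj]
  · simp

/-- The affine cone over a curve has dimension at most two. -/
theorem exists_mem_algCl_pair_of_isConePoint (hC : IsSmoothIrreducibleCurve C)
    {p : Fin (n + 1) → κ} (hp : IsConePoint (idealOf C) p) :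
    ∃ x y : κ, ∀ i, p i ∈ algCl {x, y} := by
  by_cases hp0 : p = 0
  · exact ⟨0, 0, fun i => by simp [hp0]⟩
  obtain ⟨i, hi⟩ := Function.ne_iff.1 hp0
  obtain ⟨t, ht⟩ := exists_forall_mem_algCl_singleton hC (hp.smul (p i)⁻¹)
    (a := Pi.single i 1) (by
      rw [linForm_single, aeval_X]
      exact inv_mul_cancel₀ hi)
  refine ⟨p i, t, fun j => ?_⟩
  have h1 : p j = p i * ((p i)⁻¹ • p) j := (mul_inv_cancel_left₀ hi _).symm
  rw [h1]
  refine (algCl _).mul_mem (subset_algCl _ (by simp)) (algCl_le_algCl ?_ (ht j))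
  exact (Set.singleton_subset_iff.2 (by simp)).trans (subset_algCl _)

/-- A linear space of codimension at least two meets a secant line in a point of transcendence
degree at most two (in the affine cone): if `ℓ₁`, `ℓ₂` vanish on the linear space, then
the function `ℓ₂/ℓ₁` takes the same value `r` at both ends of the secant, and if `r` is not
constant then both ends are algebraic over `ℂ(r)` up to scaling. -/
theorem exists_mem_algCl_pair_of_secant (hC : IsSmoothIrreducibleCurve C)
    (hnd : IsNondegenerate C) {N : Submodule ℂ (Fin (n + 1) → ℂ)} (hN : 2 ≤ Module.finrank ℂ N)
    {p q : Fin (n + 1) → κ} (hp : IsConePoint (idealOf C) p) (hq : IsConePoint (idealOf C) q)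
    (h : ∀ a ∈ N, aeval (p + q) (linForm a) = 0) :
    ∃ x y : κ, ∀ i, (p + q) i ∈ algCl {x, y} := by
  by_cases hp0 : p = 0
  · simpa [hp0] using exists_mem_algCl_pair_of_isConePoint hC hq
  by_cases hq0 : q = 0
  · simpa [hq0] using exists_mem_algCl_pair_of_isConePoint hC hp
  have hneg : ∀ a ∈ N, aeval q (linForm a) = -aeval p (linForm a) := fun a ha => by
    have h1 := h a ha
    rw [aeval_linForm] at h1
    rw [aeval_linForm, aeval_linForm, eq_neg_iff_add_eq_zero, ← h1, ← Finset.sum_add_distrib]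
    exact Finset.sum_congr rfl fun i _ => by
      rw [Pi.add_apply]
      ring
  by_cases hA : ∃ a ∈ N, a ≠ 0 ∧ aeval p (linForm a) = 0
  · obtain ⟨a, haN, ha0, hap⟩ := hA
    obtain ⟨c, v, hv⟩ := exists_eq_smul_of_linForm_eq_zero hC hnd hp0 hp ha0 hap
    obtain ⟨d, w, hw⟩ := exists_eq_smul_of_linForm_eq_zero hC hnd hq0 hq ha0
      (by rw [hneg a haN, hap, neg_zero])
    refine ⟨c, d, fun i => ?_⟩
    rw [Pi.add_apply, hv, hw]
    exact (algCl _).add_mem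
      ((algCl _).mul_mem (subset_algCl _ (by simp)) ((algCl _).algebraMap_mem _))
      ((algCl _).mul_mem (subset_algCl _ (by simp)) ((algCl _).algebraMap_mem _))
  · push Not at hA
    have hNpos : 0 < Module.finrank ℂ N := by omega
    obtain ⟨a₁, ha₁⟩ := (Module.finrank_pos_iff_exists_ne_zero (R := ℂ) (M := N)).1 hNpos
    obtain ⟨a₂, ha₂⟩ : ∃ a₂ : N, a₂ ∉ ℂ ∙ a₁ := by
      by_contra! hall
      have h1 : (ℂ ∙ a₁) = ⊤ := eq_top_iff.2 fun x _ => hall x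
      have h2 := finrank_span_singleton (K := ℂ) ha₁
      rw [h1, finrank_top] at h2
      omega
    have ha₁' : (a₁ : Fin (n + 1) → ℂ) ≠ 0 := fun h0 => ha₁ (Subtype.ext h0)
    set l := aeval p (linForm (a₁ : Fin (n + 1) → ℂ)) with hl
    have hl0 : l ≠ 0 := hA _ a₁.2 ha₁'
    set r := l⁻¹ * aeval p (linForm (a₂ : Fin (n + 1) → ℂ)) with hr
    have hnorm : ∀ (c : κ) (u : Fin (n + 1) → κ) (a : Fin (n + 1) → ℂ),
        aeval (c • u) (linForm a) = c * aeval u (linForm a) := fun c u a => by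
      rw [aeval_smul_of_isHomogeneous (linForm_isHomogeneous a), pow_one]
    have hrc : r ∉ algCl (∅ : Set κ) := fun hr0 => by
      obtain ⟨c, hc⟩ := exists_of_mem_algCl_empty hr0
      refine hA (a₂ + (-c) • a₁ : N) (a₂ + (-c) • a₁ : N).2 (fun h0 => ha₂ ?_) ?_
      · have h1 : a₂ + (-c) • a₁ = 0 := Subtype.ext h0
        refine Submodule.mem_span_singleton.2 ⟨c, ?_⟩
        rw [eq_neg_of_add_eq_zero_left h1]
        module
      · rw [Submodule.coe_add, Submodule.coe_smul, linForm_add, linForm_smul, map_add, map_mul,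
          aeval_C, ← hl, map_neg, hc, hr]
        field_simp
        ring
    -- both normalized endpoints are algebraic over `ℂ(r)`
    have key : ∀ u : Fin (n + 1) → κ, IsConePoint (idealOf C) u →
        aeval u (linForm (a₁ : Fin (n + 1) → ℂ)) = 1 →
        aeval u (linForm (a₂ : Fin (n + 1) → ℂ)) = r → ∀ i, u i ∈ algCl {r} := by
      intro u hu h1 h2 i
      obtain ⟨t, ht⟩ := exists_forall_mem_algCl_singleton hC hu h1
      have hrt : r ∈ algCl {t} := h2 ▸ aeval_mem_of_forall_mem ht _
      exact algCl_le_algCl (Set.singleton_subset_iff.2 (mem_algCl_exchange hrt hrc)) (ht i)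
    have hp' := key (l⁻¹ • p) (hp.smul _) (by rw [hnorm, ← hl, inv_mul_cancel₀ hl0])
      (by rw [hnorm])
    have hq' := key ((-l)⁻¹ • q) (hq.smul _)
      (by rw [hnorm, hneg _ a₁.2, ← hl, inv_mul_cancel₀ (neg_ne_zero.2 hl0)])
      (by rw [hnorm, hneg _ a₂.2, inv_neg, neg_mul_neg])
    refine ⟨l, r, fun i => ?_⟩
    have h1 : (p + q) i = l * ((l⁻¹ • p) i - ((-l)⁻¹ • q) i) := by
      simp only [Pi.add_apply, Pi.smul_apply, smul_eq_mul]
      field_simp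
      ring
    have hmono : algCl {r} ≤ algCl ({l, r} : Set κ) :=
      algCl_le_algCl ((Set.singleton_subset_iff.2 (by simp)).trans (subset_algCl _))
    rw [h1]
    exact (algCl _).mul_mem (subset_algCl _ (by simp))
      ((algCl _).sub_mem (hmono (hp' i)) (hmono (hq' i)))

/-- A matrix over a subfield that is invertible over `κ` has its inverse over the subfield. -/
theorem exists_mul_eq_one_of_forall_mem {k : ℕ} {E : IntermediateField ℂ κ}
    {M : Matrix (Fin k) (Fin k) κ} (hM : ∀ i j, M i j ∈ E) (hdet : M.det ≠ 0) :
    ∃ N : Matrix (Fin k) (Fin k) κ, (∀ i j, N i j ∈ E) ∧ N * M = 1 := by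
  let M₀ : Matrix (Fin k) (Fin k) E := Matrix.of fun i j => ⟨M i j, hM i j⟩
  have h0 : M₀.map E.val = M := rfl
  have hdet₀ : M₀.det ≠ 0 := fun h => hdet (by
    rw [← h0, ← AlgHom.mapMatrix_apply, ← AlgHom.map_det, h, map_zero])
  refine ⟨M₀⁻¹.map E.val, fun i j => (M₀⁻¹ i j).2, ?_⟩
  rw [← h0, ← Matrix.map_mul, Matrix.nonsing_inv_mul _ (isUnit_iff_ne_zero.2 hdet₀)]
  simp

/-- A hyperplane meets a tangent line in a point of transcendence degree at most two: the tangent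
line is cut out by equations over the field generated by the normalized point of tangency. -/
theorem exists_mem_algCl_pair_of_tangent {m : ℕ} {C : Set (CP (m + 1))}
    (hC : IsSmoothIrreducibleCurve C) (hnd : IsNondegenerate C) {a : Fin (m + 2) → ℂ} (ha : a ≠ 0)
    {p s : Fin (m + 2) → κ} (hp0 : p ≠ 0) (hp : IsConePoint (idealOf C) p)
    (hs : ∀ F ∈ idealOf C, gradDot F p s = 0) (has : aeval s (linForm a) = 0) :
    ∃ x y : κ, ∀ i, s i ∈ algCl {x, y} := by
  -- normalize one coordinate of the point of tangency
  obtain ⟨i₀, hi₀⟩ := Function.ne_iff.1 hp0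
  wlog hone : p i₀ = 1 generalizing p
  · refine this (p := (p i₀)⁻¹ • p) (fun h => ?_) (hp.smul _)
      (fun F hF => gradDot_smul_eq_zero hs _ hF) ?_ (inv_mul_cancel₀ hi₀)
    · exact (smul_ne_zero (inv_ne_zero hi₀) hp0) h
    · simpa using hi₀
  obtain ⟨e₀, e₁, F, hF, hdet⟩ := exists_aeval_det_jacMatrix_ne_zero hC hp0 hp
  set M := (aeval (R := ℂ) p).mapMatrix (jacMatrix e₀ e₁ F) with hM
  rw [AlgHom.map_det, ← hM] at hdet
  set x := aeval s (linForm e₀) with hx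
  set y := aeval s (linForm e₁) with hy
  have hMv : ∀ w : Fin (m + 2) → κ, (∀ F ∈ idealOf C, gradDot F p w = 0) →
      M.mulVec w = Fin.cons (aeval w (linForm e₀)) (Fin.cons (aeval w (linForm e₁)) 0) := by
    intro w hw
    funext i
    refine Fin.cases ?_ (fun i => Fin.cases ?_ (fun i => ?_) i) i
    · simp [hM, jacMatrix, Matrix.mulVec, dotProduct, aeval_linForm]
    · simp [hM, jacMatrix, Matrix.mulVec, dotProduct, aeval_linForm]
    · simpa [hM, jacMatrix, Matrix.mulVec, dotProduct, gradDot] using hw _ (hF i)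
  have hsol : ∀ N : Matrix (Fin (m + 2)) (Fin (m + 2)) κ, N * M = 1 → ∀ w : Fin (m + 2) → κ,
      (∀ F ∈ idealOf C, gradDot F p w = 0) → ∀ i,
      w i = N i 0 * aeval w (linForm e₀) + N i 1 * aeval w (linForm e₁) := by
    intro N hNM w hw i
    have h1 : w = N.mulVec (M.mulVec w) := by rw [Matrix.mulVec_mulVec, hNM, Matrix.one_mulVec]
    conv_lhs => rw [h1, hMv w hw]
    simp [Matrix.mulVec, dotProduct, Fin.sum_univ_succ]
  by_cases hap : aeval p (linForm a) = 0
  · obtain ⟨c, v, hv⟩ := exists_eq_smul_of_linForm_eq_zero hC hnd hp0 hp ha hap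
    have hc : c = algebraMap ℂ κ (v i₀)⁻¹ := by
      rw [map_inv₀]
      exact eq_inv_of_mul_eq_one_left ((hv i₀).symm.trans hone)
    have hpE : ∀ i, p i ∈ algCl (∅ : Set κ) := fun i => by
      rw [hv i, hc]
      exact (algCl _).mul_mem ((algCl _).algebraMap_mem _) ((algCl _).algebraMap_mem _)
    obtain ⟨N, hN, hNM⟩ := exists_mul_eq_one_of_forall_mem (E := algCl (∅ : Set κ))
      (fun i j => aeval_mem_of_forall_mem hpE _) hdet
    have hmono : algCl (∅ : Set κ) ≤ algCl {x, y} := algCl_le_algCl (Set.empty_subset _)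
    refine ⟨x, y, fun i => ?_⟩
    rw [hsol N hNM s hs i]
    exact (algCl _).add_mem
      ((algCl _).mul_mem (hmono (hN _ _)) (subset_algCl _ (by simp [hx])))
      ((algCl _).mul_mem (hmono (hN _ _)) (subset_algCl _ (by simp [hy])))
  · obtain ⟨t, ht⟩ := exists_forall_mem_algCl_singleton hC hp (a := Pi.single i₀ 1)
      (by rw [linForm_single, aeval_X, hone])
    obtain ⟨N, hN, hNM⟩ := exists_mul_eq_one_of_forall_mem (E := algCl {t})
      (fun i j => aeval_mem_of_forall_mem ht _) hdet
    -- the restriction of the linear form `a` to the tangent space, in the coordinates `e₀`, `e₁`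
    set α : Fin (m + 2) → κ := fun k => ∑ i, algebraMap ℂ κ (a i) * N i k with hα
    have hαE : ∀ k, α k ∈ algCl {t} := fun k =>
      (algCl _).sum_mem fun i _ => (algCl _).mul_mem ((algCl _).algebraMap_mem _) (hN i k)
    have hlin : ∀ w : Fin (m + 2) → κ, (∀ F ∈ idealOf C, gradDot F p w = 0) →
        aeval w (linForm a) = α 0 * aeval w (linForm e₀) + α 1 * aeval w (linForm e₁) := by
      intro w hw
      rw [aeval_linForm, hα, Finset.sum_mul, Finset.sum_mul, ← Finset.sum_add_distrib]
      refine Finset.sum_congr rfl fun i _ => ?_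
      rw [hsol N hNM w hw i]
      ring
    have h1 := hlin s hs
    rw [has, ← hx, ← hy] at h1
    have h2 := hlin p fun F hF => hp.gradDot_self hF
    have hrel : ∃ z, x ∈ algCl {z, t} ∧ y ∈ algCl {z, t} := by
      have hmono : ∀ z, algCl {t} ≤ algCl ({z, t} : Set κ) := fun z =>
        algCl_le_algCl ((Set.singleton_subset_iff.2 (by simp)).trans (subset_algCl _))
      by_cases hα0 : α 0 = 0
      · have hα1 : α 1 ≠ 0 := fun h => hap (by rw [h2, hα0, h]; ring)
        have hy0 : y = 0 := by simpa [hα0, hα1] using h1.symm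
        exact ⟨x, subset_algCl _ (by simp), by simp [hy0]⟩
      · refine ⟨y, ?_, subset_algCl _ (by simp)⟩
        have hxy : x = -(α 1 / α 0) * y := by
          field_simp
          linear_combination -h1
        rw [hxy]
        exact (algCl _).mul_mem ((algCl _).neg_mem
          ((algCl _).div_mem (hmono _ (hαE 1)) (hmono _ (hαE 0)))) (subset_algCl _ (by simp))
    obtain ⟨z, hxz, hyz⟩ := hrel
    refine ⟨z, t, fun i => ?_⟩
    have hmono : algCl {t} ≤ algCl ({z, t} : Set κ) :=
      algCl_le_algCl ((Set.singleton_subset_iff.2 (by simp)).trans (subset_algCl _))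
    rw [hsol N hNM s hs i]
    exact (algCl _).add_mem ((algCl _).mul_mem (hmono (hN _ _)) hxz)
      ((algCl _).mul_mem (hmono (hN _ _)) hyz)

end Count

/-! ### The secant variety of a curve contains no plane -/

section NoPlane

/-- Restriction of polynomials to the linear space spanned by the vectors `β j`. -/
noncomputable def restrictSpan {n k : ℕ} (β : Fin k → Fin (n + 1) → ℂ) :
    CoordRing n →ₐ[ℂ] MvPolynomial (Fin k) ℂ :=
  aeval fun i => ∑ j, C (β j i) * X j

theorem eval_restrictSpan {n k : ℕ} (β : Fin k → Fin (n + 1) → ℂ) (u : Fin k → ℂ)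
    (G : CoordRing n) : eval u (restrictSpan β G) = eval (∑ j, u j • β j) G := by
  have h : (aeval u).comp (restrictSpan β) = aeval (R := ℂ) (∑ j, u j • β j) := by
    refine algHom_ext fun i => ?_
    simp [restrictSpan, mul_comm]
  exact congrArg (fun f => f G) h

theorem restrictSpan_linForm {n k : ℕ} (β : Fin k → Fin (n + 1) → ℂ) (a : Fin (n + 1) → ℂ) :
    restrictSpan β (linForm a) = ∑ j, C (a ⬝ᵥ β j) * X j := by
  rw [restrictSpan, aeval_linForm]
  simp only [Finset.mul_sum, dotProduct, map_sum, map_mul, Finset.sum_mul, algebraMap_eq]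
  rw [Finset.sum_comm]
  exact Finset.sum_congr rfl fun j _ => Finset.sum_congr rfl fun i _ => by ring

/-- The generic point of a linear space of projective dimension two has transcendence degree
three in the affine cone. -/
theorem not_exists_mem_algCl_pair {n : ℕ} {β : Fin 3 → Fin (n + 1) → ℂ}
    (hβ : LinearIndependent ℂ β) {κ : Type} [Field κ] [Algebra ℂ κ] {s : Fin (n + 1) → κ}
    (hs : ∀ G, aeval s G = 0 → restrictSpan β G = 0) :
    ¬ ∃ x y : κ, ∀ i, s i ∈ algCl {x, y} := by
  rintro ⟨x, y, hxy⟩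
  obtain ⟨g, hg⟩ := (Fintype.linearCombination ℂ β).exists_leftInverse_of_injective
    (LinearMap.ker_eq_bot.2 hβ.fintypeLinearCombination_injective)
  set c : Fin 3 → Fin (n + 1) → ℂ := fun j i => g (Pi.single i 1) j with hc
  have hcβ : ∀ j k, c j ⬝ᵥ β k = if k = j then 1 else 0 := fun j k => by
    have h1 : g (β k) = Pi.single k 1 := by
      have h2 := LinearMap.congr_fun hg (Pi.single k 1)
      simpa [Fintype.linearCombination_apply] using h2
    have h3 : g (β k) j = c j ⬝ᵥ β k := by
      conv_lhs => rw [pi_eq_sum_univ' (β k)]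
      simp [hc, dotProduct, mul_comm]
    rw [← h3, h1, Pi.single_apply]
    simp [eq_comm]
  refine not_algebraicIndependent_of_mem_algCl_pair (u := fun j => aeval s (linForm (c j)))
    (fun j => aeval_mem_of_forall_mem hxy _) ?_
  rw [algebraicIndependent_iff]
  intro H hH
  rw [← MvPolynomial.comp_aeval_apply] at hH
  have h1 := hs _ hH
  rw [MvPolynomial.comp_aeval_apply] at h1
  have h2 : (fun j => restrictSpan β (linForm (c j))) = X := by
    funext j
    rw [restrictSpan_linForm, Finset.sum_eq_single j]
    · simp [hcβ]
    · intro k _ hk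
      simp [hcβ, hk]
    · simp
  rwa [h2, aeval_X_left_apply] at h1

/-- The sums of two points of the cone over `C` are dense in the cone over the secant variety, so
the generic point of a plane in the secant variety lies on a secant or a tangent. The linear forms
vanishing on the plane then bound its transcendence degree by two. -/
theorem not_linearSpace_subset_secantVariety {n : ℕ} (hn : 4 ≤ n) {C : Set (CP n)}
    (hC : IsSmoothIrreducibleCurve C) (hnd : IsNondegenerate C)
    {P : Submodule ℂ (Fin (n + 1) → ℂ)} (hP : Module.finrank ℂ P = 3) :
    ¬ linearSpace P ⊆ secantVariety 2 C := by
  intro hsub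
  let b : Module.Basis (Fin 3) ℂ P := Module.finBasisOfFinrankEq ℂ P hP
  set β : Fin 3 → Fin (n + 1) → ℂ := fun j => b j with hβdef
  have hβ : LinearIndependent ℂ β := b.linearIndependent.map' P.subtype P.ker_subtype
  have hβP : ∀ u : Fin 3 → ℂ, ∑ j, u j • β j ∈ P := fun u =>
    P.sum_mem fun j _ => P.smul_mem _ (b j).2
  -- the coordinate ring of the square of the cone over `C`, with its two tautological points
  let ι₁ : CoordRing n →ₐ[ℂ] MvPolynomial (Fin (n + 1) ⊕ Fin (n + 1)) ℂ := rename Sum.inl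
  let ι₂ : CoordRing n →ₐ[ℂ] MvPolynomial (Fin (n + 1) ⊕ Fin (n + 1)) ℂ := rename Sum.inr
  let J := (idealOf C).map ι₁ ⊔ (idealOf C).map ι₂
  let π := Ideal.Quotient.mkₐ ℂ J
  have hy : IsConePoint (idealOf C) fun i => π (X (Sum.inl i)) := fun F hF => by
    have h1 : aeval (fun i => π (X (Sum.inl i))) F = π (ι₁ F) := by
      rw [← MvPolynomial.comp_aeval_apply]
      exact congrArg π (congrArg (fun f => f F) (algHom_ext fun i => by simp [ι₁] :
        aeval (fun i => X (Sum.inl i)) = ι₁))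
    rw [h1]
    exact Ideal.Quotient.eq_zero_iff_mem.2 (Ideal.mem_sup_left (Ideal.mem_map_of_mem _ hF))
  have hz : IsConePoint (idealOf C) fun i => π (X (Sum.inr i)) := fun F hF => by
    have h1 : aeval (fun i => π (X (Sum.inr i))) F = π (ι₂ F) := by
      rw [← MvPolynomial.comp_aeval_apply]
      exact congrArg π (congrArg (fun f => f F) (algHom_ext fun i => by simp [ι₂] :
        aeval (fun i => X (Sum.inr i)) = ι₂))
    rw [h1]
    exact Ideal.Quotient.eq_zero_iff_mem.2 (Ideal.mem_sup_right (Ideal.mem_map_of_mem _ hF))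
  -- the sum of the tautological points specializes to the generic point of the plane
  have hker : ∀ G : CoordRing n,
      aeval ((fun i => π (X (Sum.inl i))) + fun i => π (X (Sum.inr i))) G = 0 →
      G ∈ RingHom.ker (restrictSpan β) := by
    intro G hG
    have h1 : ((fun i => π (X (Sum.inl i))) + fun i => π (X (Sum.inr i))) =
        fun i => π (X (Sum.inl i) + X (Sum.inr i)) := by
      funext i
      simp
    rw [h1, ← MvPolynomial.comp_aeval_apply] at hG
    have hGJ := Ideal.Quotient.eq_zero_iff_mem.1 hG
    have hvan : ∀ p ∈ linearSpace P, VanishesAt G p := fun p hp => by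
      refine vanishesAt_of_mem_secantVariety (X := C) (fun v w hv hw => ?_) (hsub hp)
      have hle : J ≤ RingHom.ker (aeval (R := ℂ) (Sum.elim v w)) := by
        refine sup_le (Ideal.map_le_iff_le_comap.2 fun F hF => ?_)
          (Ideal.map_le_iff_le_comap.2 fun F hF => ?_)
        · rw [Ideal.mem_comap, RingHom.mem_ker, aeval_rename, Sum.elim_comp_inl]
          exact hv F hF
        · rw [Ideal.mem_comap, RingHom.mem_ker, aeval_rename, Sum.elim_comp_inr]
          exact hw F hF
      have h2 := hle hGJ
      rw [RingHom.mem_ker, MvPolynomial.comp_aeval_apply] at h2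
      convert h2 using 2
      simp [aeval_eq_eval]
      rfl
    rw [RingHom.mem_ker]
    refine MvPolynomial.funext fun u => ?_
    rw [eval_restrictSpan, map_zero]
    have hmem : ∀ v, v ≠ 0 → v ∈ P → ∀ c : ℂ, eval (c • v) G = 0 := fun v hv hvP c => by
      refine hvan (Projectivization.mk ℂ v hv) ?_ _ ?_
      · change Projectivization.submodule _ ≤ P
        rw [Projectivization.submodule_mk, Submodule.span_singleton_le_iff_mem]
        exact hvP
      · rw [Projectivization.submodule_mk]
        exact Submodule.smul_mem _ _ (Submodule.mem_span_singleton_self v)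
    by_cases h0 : ∑ j, u j • β j = 0
    · rw [h0, ← zero_smul ℂ (β 0)]
      exact hmem _ (hβ.ne_zero 0) (b 0).2 0
    · rw [← one_smul ℂ (∑ j, u j • β j)]
      exact hmem _ h0 (hβP u) 1
  have hprime : (RingHom.ker (restrictSpan β)).IsPrime := RingHom.ker_isPrime _
  obtain ⟨κ, _, _, s, hs, hcase⟩ := exists_secant_or_tangent hy hz _ hker
  refine not_exists_mem_algCl_pair hβ (s := s) (fun G hG => (hs G).1 hG) ?_
  -- the linear forms vanishing on the plane; here `n ≥ 4` gives dimension at least two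
  set N := LinearMap.ker (Matrix.mulVecLin (Matrix.of β)) with hN
  have hNdim : 2 ≤ Module.finrank ℂ N := by
    have h1 := (Matrix.mulVecLin (Matrix.of β)).finrank_range_add_finrank_ker
    have h2 := Submodule.finrank_le (LinearMap.range (Matrix.mulVecLin (Matrix.of β)))
    rw [← hN] at h1
    simp only [Module.finrank_fin_fun] at h1 h2
    omega
  have hNs : ∀ a ∈ N, aeval s (linForm a) = 0 := fun a ha => by
    rw [hs, RingHom.mem_ker, restrictSpan_linForm]
    refine Finset.sum_eq_zero fun j _ => ?_
    have h1 : β j ⬝ᵥ a = 0 := congrFun (LinearMap.mem_ker.1 ha) j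
    rw [dotProduct_comm, h1, C_0, zero_mul]
  rcases hcase with ⟨p, q, hp, hq, rfl⟩ | ⟨p, hp0, hp, ht⟩
  · exact exists_mem_algCl_pair_of_secant hC hnd hNdim hp hq hNs
  · obtain ⟨m, rfl⟩ : ∃ m, n = m + 1 := ⟨n - 1, by omega⟩
    have hNpos : 0 < Module.finrank ℂ N := by omega
    obtain ⟨a, ha⟩ := (Module.finrank_pos_iff_exists_ne_zero (R := ℂ) (M := N)).1 hNpos
    exact exists_mem_algCl_pair_of_tangent hC hnd (fun h => ha (Subtype.ext h)) hp0 hp ht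
      (hNs a a.2)

end NoPlane

/-! ### Linear changes of coordinates -/

section LinSubst

variable {n : ℕ}

/-- The substitution `F ↦ F ∘ L` for an endomorphism `L` of `ℂⁿ⁺¹`. -/
noncomputable def linSubst (L : (Fin (n + 1) → ℂ) →ₗ[ℂ] (Fin (n + 1) → ℂ)) :
    CoordRing n →ₐ[ℂ] CoordRing n :=
  aeval fun i => linForm fun j => L (Pi.single j 1) i

theorem eval_linSubst (L : (Fin (n + 1) → ℂ) →ₗ[ℂ] (Fin (n + 1) → ℂ)) (F : CoordRing n)
    (v : Fin (n + 1) → ℂ) : eval v (linSubst L F) = eval (L v) F := by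
  have h : (aeval v).comp (linSubst L) = aeval (R := ℂ) (L v) := by
    refine algHom_ext fun i => ?_
    rw [AlgHom.comp_apply, linSubst, aeval_X, aeval_X, aeval_eq_eval, eval_linForm]
    conv_rhs => rw [pi_eq_sum_univ' v]
    simp [dotProduct, mul_comm]
  exact congrArg (fun f => f F) h

theorem linSubst_isHomogeneous (L : (Fin (n + 1) → ℂ) →ₗ[ℂ] (Fin (n + 1) → ℂ)) {F : CoordRing n}
    {d : ℕ} (hF : F.IsHomogeneous d) : (linSubst L F).IsHomogeneous d := by
  have h := hF.aeval _ fun i => linForm_isHomogeneous fun j => L (Pi.single j 1) i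
  rwa [one_mul] at h

theorem linSubst_linSubst (A : (Fin (n + 1) → ℂ) ≃ₗ[ℂ] (Fin (n + 1) → ℂ)) (F : CoordRing n) :
    linSubst (A : (Fin (n + 1) → ℂ) →ₗ[ℂ] _) (linSubst (A.symm : (Fin (n + 1) → ℂ) →ₗ[ℂ] _) F) =
      F :=
  MvPolynomial.funext fun v => by simp [eval_linSubst]

/-- A linear change of coordinates as an automorphism of the coordinate ring. -/
noncomputable def linSubstEquiv (A : (Fin (n + 1) → ℂ) ≃ₗ[ℂ] (Fin (n + 1) → ℂ)) :
    CoordRing n ≃ₐ[ℂ] CoordRing n :=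
  AlgEquiv.ofAlgHom (linSubst A) (linSubst A.symm)
    (AlgHom.ext fun F => linSubst_linSubst A F)
    (AlgHom.ext fun F => linSubst_linSubst A.symm F)

theorem gradDot_mul {R : Type} [CommRing R] [Algebra ℂ R] (F G : CoordRing n)
    (p w : Fin (n + 1) → R) :
    gradDot (F * G) p w = aeval p F * gradDot G p w + aeval p G * gradDot F p w := by
  simp only [gradDot, Derivation.leibniz, smul_eq_mul, map_add, map_mul, add_mul,
    Finset.sum_add_distrib, Finset.mul_sum, mul_assoc]

theorem gradDot_add {R : Type} [CommRing R] [Algebra ℂ R] (F G : CoordRing n)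
    (p w : Fin (n + 1) → R) : gradDot (F + G) p w = gradDot F p w + gradDot G p w := by
  simp only [gradDot, map_add, add_mul, Finset.sum_add_distrib]

theorem gradDot_X {R : Type} [CommRing R] [Algebra ℂ R] (i : Fin (n + 1))
    (p w : Fin (n + 1) → R) : gradDot (X i) p w = w i := by
  rw [gradDot, Finset.sum_eq_single i]
  · simp
  · intro j _ hj
    simp [hj.symm]
  · simp

theorem gradDot_C {R : Type} [CommRing R] [Algebra ℂ R] (a : ℂ)
    (p w : Fin (n + 1) → R) : gradDot (C a : CoordRing n) p w = 0 := by
  simp [gradDot]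

theorem gradDot_linForm (a v w : Fin (n + 1) → ℂ) : gradDot (linForm a) v w = a ⬝ᵥ w := by
  simp only [gradDot, linForm, map_sum, Derivation.leibniz, pderiv_C, pderiv_X, smul_eq_mul]
  refine Finset.sum_congr rfl fun i _ => ?_
  rw [Finset.sum_eq_single i]
  · simp
  · intro j _ hj
    simp [hj]
  · simp

/-- The chain rule for a linear change of coordinates. -/
theorem gradDot_linSubst (L : (Fin (n + 1) → ℂ) →ₗ[ℂ] (Fin (n + 1) → ℂ)) (F : CoordRing n)
    (v w : Fin (n + 1) → ℂ) : gradDot (linSubst L F) v w = gradDot F (L v) (L w) := by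
  induction F using MvPolynomial.induction_on with
  | C a => simp [linSubst, gradDot]
  | add F G hF hG => rw [map_add, gradDot_add, gradDot_add, hF, hG]
  | mul_X F i hF =>
    have h1 : ∀ G, aeval v (linSubst L G) = aeval (L v) G := fun G => eval_linSubst L G v
    have h2 : gradDot (linSubst L (X i)) v w = L w i := by
      rw [linSubst, aeval_X, gradDot_linForm]
      conv_rhs => rw [pi_eq_sum_univ' w]
      simp [dotProduct, mul_comm]
    rw [map_mul, gradDot_mul, gradDot_mul, hF, h1, h1, h2, gradDot_X]

theorem exists_eq_linForm {l : CoordRing n} (hl : l.IsHomogeneous 1) : ∃ a, l = linForm a := by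
  have h : l ∈ homogeneousSubmodule (Fin (n + 1)) ℂ 1 := hl
  rw [homogeneousSubmodule_one_eq_span_X, Submodule.mem_span_range_iff_exists_fun] at h
  obtain ⟨a, rfl⟩ := h
  exact ⟨a, by simp [linForm, smul_eq_C_mul]⟩

theorem eval_zero_of_isHomogeneous {d : ℕ} {F : CoordRing n} (hF : F.IsHomogeneous d)
    (hd : d ≠ 0) : eval 0 F = 0 := by
  have h := eval_smul_of_isHomogeneous hF 0 0
  rwa [zero_smul, zero_pow hd, zero_mul] at h

theorem not_isUnit_of_isHomogeneous {d : ℕ} {F : CoordRing n} (hF : F.IsHomogeneous d)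
    (hd : d ≠ 0) : ¬ IsUnit F := fun h => by
  have h1 := h.map (eval (0 : Fin (n + 1) → ℂ))
  rw [eval_zero_of_isHomogeneous hF hd] at h1
  exact not_isUnit_zero h1

end LinSubst

/-! ### The Hankel cubic -/

section Hankel

/-- The determinant of the Hankel matrix with entries `x₀, …, x₄`, expanded in powers of `x₄`. -/
noncomputable def hankelCubic : CoordRing 4 :=
  (X 0 * X 2 + -X 1 ^ 2) * X 4 + (-(X 0 * X 3 ^ 2) + 2 * X 1 * X 2 * X 3 - X 2 ^ 3)

theorem hankelCubic_eq_slices : hankelCubic =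
    X 0 * (X 2 * X 4 - X 3 ^ 2) + X 1 * (X 2 * X 3 - X 1 * X 4) +
      X 2 * (X 1 * X 3 - X 2 ^ 2) := by
  rw [hankelCubic]
  ring

theorem eval_hankelCubic (x : Fin 5 → ℂ) : eval x hankelCubic =
    (x 0 * x 2 - x 1 ^ 2) * x 4 - x 0 * x 3 ^ 2 + 2 * x 1 * x 2 * x 3 - x 2 ^ 3 := by
  simp only [hankelCubic, map_add, map_sub, map_mul, map_neg, map_pow, eval_X, map_ofNat]
  ring

theorem isHomogeneous_X_mul_X_sub {a b c d : Fin 5} :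
    (X a * X b - X c * X d : CoordRing 4).IsHomogeneous 2 :=
  ((isHomogeneous_X ℂ a).mul (isHomogeneous_X ℂ b)).sub
    ((isHomogeneous_X ℂ c).mul (isHomogeneous_X ℂ d))

theorem hankelCubic_isHomogeneous : hankelCubic.IsHomogeneous 3 := by
  rw [hankelCubic_eq_slices]
  simp only [sq]
  exact (((isHomogeneous_X ℂ 0).mul isHomogeneous_X_mul_X_sub).add
    ((isHomogeneous_X ℂ 1).mul isHomogeneous_X_mul_X_sub)).add
    ((isHomogeneous_X ℂ 2).mul isHomogeneous_X_mul_X_sub)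

theorem notMem_vars_of_mem_supported {i : Fin 5} {F : CoordRing 4}
    (hF : F ∈ supported ℂ ({i}ᶜ : Set (Fin 5))) : i ∉ F.vars := fun h =>
  (mem_supported.1 hF) h rfl

theorem irreducible_hankel_minor : Irreducible (X 0 * X 2 + -X 1 ^ 2 : CoordRing 4) := by
  refine irreducible_mul_X_add _ _ 2 (X_ne_zero 0) ?_ ?_ ?_
  · exact notMem_vars_of_mem_supported (X_mem_supported.2 (by decide))
  · exact notMem_vars_of_mem_supported
      (neg_mem (pow_mem (X_mem_supported.2 (by decide)) 2))
  · rw [(X_prime (i := (0 : Fin 5))).irreducible.isRelPrime_iff_not_dvd]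
    rintro ⟨G, hG⟩
    have h := congrArg (eval (![0, 1, 0, 0, 0] : Fin 5 → ℂ)) hG
    simp at h

/-- The cubic has degree one in `x₄`, with irreducible leading coefficient `x₀x₂ - x₁²`. -/
theorem irreducible_hankelCubic : Irreducible hankelCubic := by
  have hX : ∀ i : Fin 5, i ≠ 4 → (X i : CoordRing 4) ∈ supported ℂ ({4}ᶜ : Set (Fin 5)) :=
    fun i hi => X_mem_supported.2 hi
  refine irreducible_mul_X_add _ _ 4 irreducible_hankel_minor.ne_zero ?_ ?_ ?_
  · refine notMem_vars_of_mem_supported (add_mem (mul_mem (hX 0 ?_) (hX 2 ?_))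
      (neg_mem (pow_mem (hX 1 ?_) 2))) <;> decide
  · refine notMem_vars_of_mem_supported (sub_mem (add_mem (neg_mem (mul_mem (hX 0 ?_)
      (pow_mem (hX 3 ?_) 2))) (mul_mem (mul_mem (mul_mem (ofNat_mem _ 2) (hX 1 ?_)) (hX 2 ?_))
      (hX 3 ?_))) (pow_mem (hX 2 ?_) 3)) <;> decide
  · rw [irreducible_hankel_minor.isRelPrime_iff_not_dvd]
    rintro ⟨G, hG⟩
    have h := congrArg (eval (![1, 0, 0, 1, 0] : Fin 5 → ℂ)) hG
    simp at h

/-- The point with parameters `t` on the cone over the standard rational normal quartic. -/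
def moment (t : Fin 2 → ℂ) : Fin 5 → ℂ := fun i => t 0 ^ (4 - (i : ℕ)) * t 1 ^ (i : ℕ)

theorem moment_affine (t : ℂ) : moment ![1, t] = ![1, t, t ^ 2, t ^ 3, t ^ 4] := by
  funext i
  fin_cases i <;> simp [moment]

theorem moment_infinity (t : ℂ) : moment ![t, 1] = ![t ^ 4, t ^ 3, t ^ 2, t, 1] := by
  funext i
  fin_cases i <;> simp [moment]

theorem eval_hankelCubic_secant (c d : ℂ) (t u : Fin 2 → ℂ) :
    eval (c • moment t + d • moment u) hankelCubic = 0 := by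
  rw [eval_hankelCubic]
  simp [moment]
  ring

/-- The cubic is singular along the rational normal curve. -/
theorem gradDot_hankelCubic_moment (t : Fin 2 → ℂ) (w : Fin 5 → ℂ) :
    gradDot hankelCubic (moment t) w = 0 := by
  rw [hankelCubic_eq_slices]
  simp only [sub_eq_add_neg, sq, neg_eq_neg_one_mul (_ * _ : CoordRing 4)]
  rw [show (-1 : CoordRing 4) = C (-1) by simp]
  simp only [gradDot_add, gradDot_mul, gradDot_X, gradDot_C, map_add, map_mul, aeval_X, aeval_C]
  simp [moment]
  ring

/-- Continuity in the parameter of a polynomial curve carries the vanishing of `F` to the limit. -/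
theorem eval_eq_zero_of_forall_ne {F : CoordRing 4} (y : ℂ → Fin 5 → ℂ) (hy : Continuous y)
    (h : ∀ s, s ≠ 0 → eval (y s) F = 0) : eval (y 0) F = 0 := by
  have hc : Continuous fun s => eval (y s) F := (MvPolynomial.continuous_eval F).comp hy
  have hcl : IsClosed {s | eval (y s) F = 0} := isClosed_eq hc continuous_const
  have hd : Dense ({0}ᶜ : Set ℂ) := dense_compl_singleton 0
  have := hcl.closure_subset_iff.2 (fun s hs => h s hs : ({0}ᶜ : Set ℂ) ⊆ _)
  exact this (hd 0)

/-- Every zero of the Hankel cubic is a limit of points on secants of the rational normal curve.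
A kernel vector of the Hankel matrix is a quadratic recurrence satisfied by `x₀, …, x₄`; its
characteristic roots are the two points of contact of the secant. -/
theorem eval_eq_zero_of_eval_hankelCubic {F : CoordRing 4}
    (hF : ∀ (c d : ℂ) (t u : Fin 2 → ℂ), eval (c • moment t + d • moment u) F = 0)
    {x : Fin 5 → ℂ} (hx : eval x hankelCubic = 0) : eval x F = 0 := by
  have hdet : (!![x 0, x 1, x 2; x 1, x 2, x 3; x 2, x 3, x 4] : Matrix _ _ ℂ).det = 0 := by
    rw [Matrix.det_fin_three, ← hx, eval_hankelCubic]
    simp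
    ring
  obtain ⟨c, hc0, hc⟩ := Matrix.exists_mulVec_eq_zero_iff.2 hdet
  have e0 : x 0 * c 0 + x 1 * c 1 + x 2 * c 2 = 0 := by
    simpa [Matrix.mulVec, dotProduct, Fin.sum_univ_succ, add_assoc] using congrFun hc 0
  have e1 : x 1 * c 0 + x 2 * c 1 + x 3 * c 2 = 0 := by
    simpa [Matrix.mulVec, dotProduct, Fin.sum_univ_succ, add_assoc] using congrFun hc 1
  have e2 : x 2 * c 0 + x 3 * c 1 + x 4 * c 2 = 0 := by
    simpa [Matrix.mulVec, dotProduct, Fin.sum_univ_succ, add_assoc] using congrFun hc 2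
  by_cases hc2 : c 2 = 0
  · by_cases hc1 : c 1 = 0
    · -- the tangent line at infinity
      have hc00 : c 0 ≠ 0 := fun h => hc0 (by funext i; fin_cases i <;> simp [*])
      have x0 : x 0 = 0 := by simpa [hc1, hc2, hc00] using e0
      have x1 : x 1 = 0 := by simpa [hc1, hc2, hc00] using e1
      have x2 : x 2 = 0 := by simpa [hc1, hc2, hc00] using e2
      have h := eval_eq_zero_of_forall_ne (F := F)
        (fun s => ![x 3 * s ^ 3, x 3 * s ^ 2, x 3 * s, x 3, x 4])
        (by fun_prop) (fun s hs => ?_)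
      · convert h using 3
        funext i
        fin_cases i <;> simp [x0, x1, x2]
      · convert hF (x 3 / s) (x 4 - x 3 / s) ![s, 1] ![0, 1] using 3
        rw [moment_infinity, moment_infinity]
        funext i
        fin_cases i <;> simp <;> field_simp
    · -- one of the two points of contact is at infinity
      set t := -c 0 / c 1 with ht
      have hrec : ∀ a b d : ℂ, a * c 0 + b * c 1 + d * c 2 = 0 → b = t * a := fun a b d h => by
        rw [hc2, mul_zero, add_zero] at h
        rw [ht]
        field_simp
        linear_combination h
      have x1 := hrec _ _ _ e0
      have x2 := hrec _ _ _ e1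
      have x3 := hrec _ _ _ e2
      convert hF (x 0) (x 4 - t ^ 4 * x 0) ![1, t] ![0, 1] using 3
      rw [moment_affine, moment_infinity]
      funext i
      fin_cases i <;> simp [x3, x2, x1] <;> ring
  · obtain ⟨t, ht⟩ := IsAlgClosed.exists_root
      (Polynomial.C (c 2) * Polynomial.X ^ 2 + Polynomial.C (c 1) * Polynomial.X +
        Polynomial.C (c 0)) (by rw [Polynomial.degree_quadratic hc2]; decide)
    simp only [Polynomial.IsRoot.def, Polynomial.eval_add, Polynomial.eval_mul, Polynomial.eval_C,
      Polynomial.eval_pow,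
      Polynomial.eval_X] at ht
    set u := -c 1 / c 2 - t with hu
    have hsum : c 1 = -(t + u) * c 2 := by
      rw [hu]
      field_simp
      ring
    have hprod : c 0 = t * u * c 2 := by
      rw [hsum] at ht
      linear_combination ht
    have hrec : ∀ a b d : ℂ, a * c 0 + b * c 1 + d * c 2 = 0 → d = (t + u) * b - t * u * a :=
      fun a b d h => by
        rw [hsum, hprod] at h
        exact mul_right_cancel₀ hc2 (by linear_combination h)
    have x2 := hrec _ _ _ e0
    have x3 := hrec _ _ _ e1
    have x4 := hrec _ _ _ e2
    by_cases htu : t = u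
    · -- the tangent line at a finite point
      rw [← htu] at x2 x3 x4
      set b := x 1 - t * x 0 with hb
      have x1 : x 1 = t * x 0 + b := by rw [hb]; ring
      have h := eval_eq_zero_of_forall_ne (F := F)
        (fun s => ![x 0, x 0 * t + b, x 0 * t ^ 2 + b * (2 * t + s),
          x 0 * t ^ 3 + b * (3 * t ^ 2 + 3 * t * s + s ^ 2),
          x 0 * t ^ 4 + b * (4 * t ^ 3 + 6 * t ^ 2 * s + 4 * t * s ^ 2 + s ^ 3)])
        (by fun_prop) (fun s hs => ?_)
      · convert h using 3
        funext i
        fin_cases i <;> simp [x4, x3, x2, x1] <;> ring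
      · convert hF (x 0 - b / s) (b / s) ![1, t] ![1, t + s] using 3
        rw [moment_affine, moment_affine]
        funext i
        fin_cases i <;> simp <;> field_simp <;> ring
    · have htu' : u - t ≠ 0 := sub_ne_zero.2 (Ne.symm htu)
      set b := (x 1 - t * x 0) / (u - t) with hb
      have x1 : x 1 = t * x 0 + b * (u - t) := by
        rw [hb]
        field_simp
        ring
      convert hF (x 0 - b) b ![1, t] ![1, u] using 3
      rw [moment_affine, moment_affine]
      funext i
      fin_cases i <;> simp [x4, x3, x2, x1] <;> ring

end Hankel

/-! ### The slice rank of the Hankel cubic -/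

section SliceRank

/-- Complex polynomials with vanishing Wronskian are linearly dependent: after subtracting a
multiple of `p`, the degrees differ, and then the leading terms do not cancel. -/
theorem exists_eq_C_mul_of_wronskian_eq_zero {p q : Polynomial ℂ} (hp : p ≠ 0)
    (h : p * Polynomial.derivative q - Polynomial.derivative p * q = 0) :
    ∃ c, q = Polynomial.C c * p := by
  set c := q.coeff p.natDegree / p.leadingCoeff with hc
  refine ⟨c, ?_⟩
  set r := q - Polynomial.C c * p with hr
  have hlc : p.leadingCoeff ≠ 0 := Polynomial.leadingCoeff_ne_zero.2 hp
  have hr0 : r.coeff p.natDegree = 0 := by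
    rw [hr, Polynomial.coeff_sub, Polynomial.coeff_C_mul, hc, Polynomial.coeff_natDegree]
    field_simp
    ring
  have hW : p * (Polynomial.X * Polynomial.derivative r) =
      Polynomial.X * Polynomial.derivative p * r := by
    rw [hr, Polynomial.derivative_sub, Polynomial.derivative_C_mul]
    linear_combination Polynomial.X * h
  by_contra hne
  have hrne : r ≠ 0 := fun h0 => hne (sub_eq_zero.1 h0)
  have hdeg : r.natDegree ≠ p.natDegree := fun h0 => by
    rw [← h0, Polynomial.coeff_natDegree, Polynomial.leadingCoeff_eq_zero] at hr0
    exact hrne hr0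
  have hX : ∀ s : Polynomial ℂ, (Polynomial.X * Polynomial.derivative s).natDegree ≤ s.natDegree ∧
      (Polynomial.X * Polynomial.derivative s).coeff s.natDegree =
        s.natDegree * s.leadingCoeff := by
    intro s
    have hco : ∀ k, (Polynomial.X * Polynomial.derivative s).coeff k = k * s.coeff k := by
      rintro (_ | k)
      · simp
      · rw [Polynomial.coeff_X_mul, Polynomial.coeff_derivative]
        push_cast
        ring
    refine ⟨Polynomial.natDegree_le_iff_coeff_eq_zero.2 fun k hk => ?_, hco _⟩
    rw [hco, Polynomial.coeff_eq_zero_of_natDegree_lt hk, mul_zero]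
  have h1 : Polynomial.coeff _ (p.natDegree + r.natDegree) = Polynomial.coeff _ _ :=
    congrArg (fun s => Polynomial.coeff s (p.natDegree + r.natDegree)) hW
  rw [Polynomial.coeff_mul_add_eq_of_natDegree_le le_rfl (hX r).1,
    Polynomial.coeff_mul_add_eq_of_natDegree_le (hX p).1 le_rfl, (hX r).2, (hX p).2,
    Polynomial.coeff_natDegree, Polynomial.coeff_natDegree] at h1
  have hlr : r.leadingCoeff ≠ 0 := Polynomial.leadingCoeff_ne_zero.2 hrne
  have h2 : ((r.natDegree : ℂ) - p.natDegree) * (p.leadingCoeff * r.leadingCoeff) = 0 := by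
    linear_combination h1
  rcases mul_eq_zero.1 h2 with h3 | h3
  · exact hdeg (Nat.cast_injective (sub_eq_zero.1 h3))
  · exact mul_ne_zero hlc hlr h3

/-- The restriction of the linear form with coefficients `a` to the affine moment curve. -/
noncomputable def momentPoly (a : Fin 5 → ℂ) : Polynomial ℂ :=
  ∑ i : Fin 5, Polynomial.monomial (i : ℕ) (a i)

theorem coeff_momentPoly (a : Fin 5 → ℂ) (i : Fin 5) : (momentPoly a).coeff i = a i := by
  rw [momentPoly, Polynomial.finsetSum_coeff, Finset.sum_eq_single i]
  · simp
  · intro j _ hj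
    rw [Polynomial.coeff_monomial, if_neg fun h => hj (Fin.ext h)]
  · simp

theorem C_mul_momentPoly (c : ℂ) (a : Fin 5 → ℂ) :
    Polynomial.C c * momentPoly a = momentPoly (c • a) := by
  simp [momentPoly, Finset.mul_sum, Polynomial.C_mul_monomial]

theorem momentPoly_injective : Function.Injective momentPoly := fun a b h => funext fun i => by
  rw [← coeff_momentPoly a, h, coeff_momentPoly]

theorem linForm_mul_ne_hankelCubic (a : Fin 5 → ℂ) {h : CoordRing 4} (hh : h.IsHomogeneous 2) :
    hankelCubic ≠ linForm a * h := fun heq =>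
  (irreducible_hankelCubic.isUnit_or_isUnit heq).elim
    (not_isUnit_of_isHomogeneous (linForm_isHomogeneous a) one_ne_zero)
    (not_isUnit_of_isHomogeneous hh two_ne_zero)

/-- The Hankel cubic has slice rank greater than two. If it vanished on the common zeros of the
linear forms `a` and `b`, it would vanish at a nonzero vector of every osculating space
`⟨γ, γ', γ''⟩` of the moment curve `γ` on which `a` and `b` vanish. The cubic restricts to minus
the cube of the coefficient of `γ''/2`, so that vector is tangent to the curve, and the Wronskian of
the restrictions of `a` and `b` to the curve vanishes everywhere. -/
theorem hankelCubic_ne_add (a b : Fin 5 → ℂ) {g h : CoordRing 4} (hg : g.IsHomogeneous 2)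
    (hh : h.IsHomogeneous 2) : hankelCubic ≠ linForm a * g + linForm b * h := by
  intro heq
  have hW : momentPoly a * Polynomial.derivative (momentPoly b) -
      Polynomial.derivative (momentPoly a) * momentPoly b = 0 := by
    refine Polynomial.funext fun t => ?_
    -- `γ(t)`, `γ'(t)`, `γ''(t)/2`, and the coefficients `c` of a combination killed by `a` and `b`
    let v : Fin 3 → Fin 5 → ℂ := ![![1, t, t ^ 2, t ^ 3, t ^ 4],
      ![0, 1, 2 * t, 3 * t ^ 2, 4 * t ^ 3], ![0, 0, 1, 3 * t, 6 * t ^ 2]]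
    let L : (Fin 3 → ℂ) →ₗ[ℂ] (Fin 2 → ℂ) :=
      Matrix.mulVecLin (Matrix.of fun i j => (![a, b] i) ⬝ᵥ v j)
    obtain ⟨c, hcL, hc0⟩ := (Submodule.ne_bot_iff _).1
      (LinearMap.ker_ne_bot_of_finrank_lt (f := L) (by simp))
    have hdot : ∀ (e : Fin 5 → ℂ) , e ⬝ᵥ (c 0 • v 0 + c 1 • v 1 + c 2 • v 2) =
        (e ⬝ᵥ v 0) * c 0 + (e ⬝ᵥ v 1) * c 1 + (e ⬝ᵥ v 2) * c 2 := fun e => by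
      simp only [dotProduct_add, dotProduct_smul, smul_eq_mul]
      ring
    have ha : (a ⬝ᵥ v 0) * c 0 + (a ⬝ᵥ v 1) * c 1 + (a ⬝ᵥ v 2) * c 2 = 0 := by
      simpa [L, Matrix.mulVec, Fin.sum_univ_succ, dotProduct, add_assoc] using congrFun hcL 0
    have hb : (b ⬝ᵥ v 0) * c 0 + (b ⬝ᵥ v 1) * c 1 + (b ⬝ᵥ v 2) * c 2 = 0 := by
      simpa [L, Matrix.mulVec, Fin.sum_univ_succ, dotProduct, add_assoc] using congrFun hcL 1
    have hz : eval (c 0 • v 0 + c 1 • v 1 + c 2 • v 2) hankelCubic = 0 := by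
      rw [heq, map_add, map_mul, map_mul, eval_linForm, eval_linForm, hdot, hdot, ha, hb]
      ring
    have hcube : c 2 ^ 3 = 0 := by
      rw [← neg_eq_zero, ← hz, eval_hankelCubic]
      simp [v]
      ring
    have hc2 : c 2 = 0 := (pow_eq_zero_iff (by norm_num)).1 hcube
    rw [hc2, mul_zero, add_zero] at ha hb
    have hval : ∀ e : Fin 5 → ℂ, (momentPoly e).eval t = e ⬝ᵥ v 0 ∧
        (Polynomial.derivative (momentPoly e)).eval t = e ⬝ᵥ v 1 := fun e => by
      constructor
      · simp [momentPoly, Fin.sum_univ_succ, dotProduct, v]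
      · simp [momentPoly, Fin.sum_univ_succ, dotProduct, v]
        ring
    simp only [Polynomial.eval_sub, Polynomial.eval_mul, (hval _).1, (hval _).2,
      Polynomial.eval_zero]
    by_cases hc00 : c 0 = 0
    · have hc1 : c 1 ≠ 0 := fun h1 => hc0 (by funext i; fin_cases i <;> simp [*])
      refine mul_right_cancel₀ hc1 ?_
      linear_combination (a ⬝ᵥ v 0) * hb - (b ⬝ᵥ v 0) * ha
    · refine mul_right_cancel₀ hc00 ?_
      linear_combination (b ⬝ᵥ v 1) * ha - (a ⬝ᵥ v 1) * hb
  by_cases ha0 : momentPoly a = 0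
  · have h0 : a = 0 := momentPoly_injective (by simpa [momentPoly] using ha0)
    refine linForm_mul_ne_hankelCubic b hh ?_
    rw [heq, h0]
    simp [linForm]
  · obtain ⟨c, hc⟩ := exists_eq_C_mul_of_wronskian_eq_zero ha0 hW
    rw [C_mul_momentPoly] at hc
    refine linForm_mul_ne_hankelCubic a
      (hg.add (by simpa using (isHomogeneous_C _ c).mul hh : (C c * h).IsHomogeneous 2)) ?_
    rw [heq, momentPoly_injective hc, linForm_smul]
    ring

end SliceRank

/-! ### The secant variety of a rational normal quartic -/

section Quartic

variable (A : (Fin 5 → ℂ) ≃ₗ[ℂ] (Fin 5 → ℂ))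

/-- The rational normal quartic obtained from the standard one by the change of coordinates `A`. -/
def quarticCurve : Set (CP 4) :=
  {p | ∃ t : Fin 2 → ℂ, t ≠ 0 ∧ p.submodule = ℂ ∙ A (moment t)}

/-- The Hankel cubic in the coordinates given by `A`. -/
noncomputable def quarticCubic : Forms 4 3 :=
  ⟨linSubst A.symm hankelCubic, linSubst_isHomogeneous _ hankelCubic_isHomogeneous⟩

theorem eval_quarticCubic (v : Fin 5 → ℂ) :
    eval v (quarticCubic A : CoordRing 4) = eval (A.symm v) hankelCubic :=
  eval_linSubst _ _ _

theorem irreducible_quarticCubic : Irreducible (quarticCubic A : CoordRing 4) :=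
  (MulEquiv.irreducible_iff (linSubstEquiv A.symm)).2 irreducible_hankelCubic

theorem moment_ne_zero {t : Fin 2 → ℂ} (ht : t ≠ 0) : moment t ≠ 0 := fun h => ht <| by
  have h0 := congrFun h 0
  have h4 := congrFun h 4
  simp [moment] at h0 h4
  funext i
  fin_cases i
  · exact h0
  · exact h4

theorem projZeroLocus_singleton {n : ℕ} (F : CoordRing n) :
    projZeroLocus {F} = {p | VanishesAt F p} := by
  ext p
  simp [projZeroLocus]

/-- The Hankel cubic vanishes on all secants; conversely, its zeros lie in every closed set that
contains the secants. -/
theorem projZeroLocus_quarticCubic :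
    projZeroLocus {(quarticCubic A : CoordRing 4)} = secantVariety 2 (quarticCurve A) := by
  rw [projZeroLocus_singleton]
  refine Set.Subset.antisymm (fun p hp => ?_)
    (closure_minimal ?_ (isClosed_setOf_vanishesAt _))
  · rw [secantVariety, ← projZeroLocus_idealOf isClosed_closure]
    intro F hF v hv
    have hF' : ∀ (c d : ℂ) (t u : Fin 2 → ℂ),
        eval (c • moment t + d • moment u) (linSubst A F) = 0 := by
      -- parameters `t, u ≠ 0` give points of the curve, while `moment 0 = 0`
      have hm0 : moment 0 = 0 := by
        funext i
        fin_cases i <;> simp [moment]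
      have key : ∀ (c d : ℂ) (t u : Fin 2 → ℂ), t ≠ 0 → u ≠ 0 →
          eval (c • moment t + d • moment u) (linSubst A F) = 0 := by
        intro c d t u ht hu
        have hAt : A (moment t) ≠ 0 := A.map_ne_zero_iff.2 (moment_ne_zero ht)
        have hAu : A (moment u) ≠ 0 := A.map_ne_zero_iff.2 (moment_ne_zero hu)
        have hmem : ∀ w, w ≠ 0 → w ∈ (ℂ ∙ A (moment t)) ⊔ (ℂ ∙ A (moment u)) →
            ∀ s : ℂ, eval (s • w) F = 0 := by
          intro w hw hwm s
          refine hF (Projectivization.mk ℂ w hw) (subset_closure ?_) _ ?_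
          · refine ⟨![Projectivization.mk ℂ _ hAt, Projectivization.mk ℂ _ hAu],
              Fin.forall_fin_two.2 ⟨⟨t, ht, Projectivization.submodule_mk _ _⟩,
                ⟨u, hu, Projectivization.submodule_mk _ _⟩⟩, ?_⟩
            change Projectivization.submodule _ ≤ _
            rw [Projectivization.submodule_mk, Submodule.span_singleton_le_iff_mem]
            refine (?_ : (ℂ ∙ A (moment t)) ⊔ (ℂ ∙ A (moment u)) ≤ _) hwm
            refine sup_le ?_ ?_
            · refine le_trans ?_ (le_iSup _ 0)
              simp [Projectivization.submodule_mk]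
            · refine le_trans ?_ (le_iSup _ 1)
              simp [Projectivization.submodule_mk]
          · rw [Projectivization.submodule_mk]
            exact Submodule.smul_mem _ _ (Submodule.mem_span_singleton_self w)
        rw [eval_linSubst]
        change eval (A (c • moment t + d • moment u)) F = 0
        by_cases h0 : A (c • moment t + d • moment u) = 0
        · rw [h0, ← zero_smul ℂ (A (moment t))]
          exact hmem _ hAt (Submodule.mem_sup_left (Submodule.mem_span_singleton_self _)) 0
        · rw [← one_smul ℂ (A (c • moment t + d • moment u))]
          refine hmem _ h0 ?_ 1
          rw [map_add, map_smul, map_smul]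
          exact Submodule.add_mem_sup (Submodule.smul_mem _ _ (Submodule.mem_span_singleton_self _))
            (Submodule.smul_mem _ _ (Submodule.mem_span_singleton_self _))
      have h1 : (![1, 0] : Fin 2 → ℂ) ≠ 0 := fun h => one_ne_zero (congrFun h 0)
      intro c d t u
      by_cases ht : t = 0 <;> by_cases hu : u = 0
      · simpa [ht, hu, hm0] using key 0 0 _ _ h1 h1
      · simpa [ht, hm0] using key 0 d _ u h1 hu
      · simpa [hu, hm0] using key c 0 t _ ht h1
      · exact key c d t u ht hu
    have h := eval_eq_zero_of_eval_hankelCubic hF' (x := A.symm v)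
      ((eval_quarticCubic A v).symm.trans (hp v hv))
    rw [eval_linSubst] at h
    simpa using h
  · rintro q ⟨p, hpC, hq⟩ u hu
    have h1 := hq hu
    have h2 : ⨆ i, (p i).submodule ≤ (p 0).submodule ⊔ (p 1).submodule :=
      iSup_le (Fin.forall_fin_two.2 ⟨le_sup_left, le_sup_right⟩)
    obtain ⟨v, hv, w, hw, rfl⟩ := Submodule.mem_sup.1 (h2 h1)
    obtain ⟨t, -, ht⟩ := hpC 0
    obtain ⟨s, -, hs⟩ := hpC 1
    rw [ht] at hv
    rw [hs] at hw
    obtain ⟨c, rfl⟩ := Submodule.mem_span_singleton.1 hv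
    obtain ⟨d, rfl⟩ := Submodule.mem_span_singleton.1 hw
    rw [eval_quarticCubic]
    simpa using eval_hankelCubic_secant c d t s

/-- An irreducible form is determined up to scalars, among forms of its degree, by its zeros. -/
theorem exists_eq_smul_of_projZeroLocus_eq {n d : ℕ} {f g : Forms n d}
    (hf : Irreducible (f : CoordRing n))
    (hg : projZeroLocus {(g : CoordRing n)} = projZeroLocus {(f : CoordRing n)})
    (hd : d ≠ 0) : ∃ a : ℂ, a ≠ 0 ∧ g = a • f := by
  have hfp : Prime (f : CoordRing n) := hf.prime
  have hzero : ∀ {F G : Forms n d}, projZeroLocus {(F : CoordRing n)} =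
      projZeroLocus {(G : CoordRing n)} → ∀ v, eval v (F : CoordRing n) = 0 →
        eval v (G : CoordRing n) = 0 := by
    intro F G h v hv
    by_cases hv0 : v = 0
    · rw [hv0]
      exact eval_zero_of_isHomogeneous G.2 hd
    · rw [projZeroLocus_singleton, projZeroLocus_singleton] at h
      have h1 : Projectivization.mk ℂ v hv0 ∈ {p | VanishesAt (F : CoordRing n) p} :=
        (vanishesAt_mk_iff F.2 hv0).2 hv
      rw [h] at h1
      exact (vanishesAt_mk_iff G.2 hv0).1 h1
  have hdvd : (f : CoordRing n) ∣ g := by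
    have h1 : (g : CoordRing n) ∈ vanishingIdeal ℂ (zeroLocus ℂ (Ideal.span {(f : CoordRing n)})) :=
      fun v hv => hzero hg.symm v (hv _ (Ideal.mem_span_singleton_self _))
    have : (Ideal.span {(f : CoordRing n)}).IsPrime :=
      (Ideal.span_singleton_prime hfp.ne_zero).2 hfp
    rw [IsPrime.vanishingIdeal_zeroLocus] at h1
    exact Ideal.mem_span_singleton.1 h1
  have hg0 : (g : CoordRing n) ≠ 0 := fun h0 => hfp.ne_zero <|
    MvPolynomial.funext fun v => by
      rw [map_zero]
      exact hzero hg v (by rw [h0, map_zero])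
  obtain ⟨h, hh⟩ := hdvd
  have hh0 : h ≠ 0 := fun h0 => hg0 (by rw [hh, h0, mul_zero])
  have hdeg := congrArg totalDegree hh
  rw [totalDegree_mul_of_isDomain hfp.ne_zero hh0, g.2.totalDegree hg0,
    f.2.totalDegree hfp.ne_zero] at hdeg
  obtain ⟨a, rfl⟩ : ∃ a, h = C a := ⟨_, totalDegree_eq_zero_iff_eq_C.1 (by omega)⟩
  refine ⟨a, fun h0 => hh0 (by rw [h0, C_0]), Subtype.ext ?_⟩
  rw [Submodule.coe_smul, smul_eq_C_mul, hh, mul_comm]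

/-- A decomposition with fewer than three summands is padded to one with two summands. -/
theorem hankelCubic_ne_sum {r : ℕ} (hr : r < 3) (a : Fin r → Fin 5 → ℂ) {h : Fin r → CoordRing 4}
    (hh : ∀ i, (h i).IsHomogeneous 2) : hankelCubic ≠ ∑ i, linForm (a i) * h i := by
  have h0 : (0 : CoordRing 4).IsHomogeneous 2 := isHomogeneous_zero _ _ _
  interval_cases r
  · simpa using hankelCubic_ne_add 0 0 h0 h0
  · simpa using hankelCubic_ne_add (a 0) 0 (hh 0) h0
  · simpa using hankelCubic_ne_add (a 0) (a 1) (hh 0) (hh 1)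

theorem three_le_sliceRank_quarticCubic : 3 ≤ sliceRank (quarticCubic A) := by
  have hne : {r | HasSliceDecomposition (quarticCubic A) r}.Nonempty := by
    have hq : ∀ a b c d : Fin 5,
        (linSubst (n := 4) A.symm (X a * X b - X c * X d)).IsHomogeneous 2 :=
      fun _ _ _ _ => linSubst_isHomogeneous _ isHomogeneous_X_mul_X_sub
    refine ⟨3, fun i => linSubst A.symm (![X 0, X 1, X 2] i),
      fun i => linSubst A.symm (![X 2 * X 4 - X 3 * X 3, X 2 * X 3 - X 1 * X 4,
        X 1 * X 3 - X 2 * X 2] i), fun i => ?_, fun i => ?_, ?_⟩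
    · fin_cases i <;> exact linSubst_isHomogeneous _ (isHomogeneous_X ℂ _)
    · fin_cases i <;> exact hq _ _ _ _
    · simp only [quarticCubic, hankelCubic_eq_slices, Fin.sum_univ_three, map_add, map_mul, sq]
      rfl
  by_contra! hlt
  obtain ⟨ℓ, h, hℓ, hh, hf⟩ := Nat.sInf_mem hne
  have hlin : ∀ i, ∃ a, linSubst (n := 4) A (ℓ i) = linForm a := fun i =>
    exists_eq_linForm (linSubst_isHomogeneous _ (hℓ i))
  choose a ha using hlin
  refine hankelCubic_ne_sum hlt a (fun i => linSubst_isHomogeneous A.toLinearMap (hh i)) ?_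
  rw [← linSubst_linSubst A hankelCubic]
  refine (congrArg (linSubst (n := 4) A) hf).trans ?_
  rw [map_sum]
  exact Finset.sum_congr rfl fun i _ => by rw [map_mul, ha]

end Quartic

/-! ### The rank of the Ruppert map -/

section Rank

theorem homogeneousSubmodule_le_span (n d : ℕ) :
    Forms n d ≤ Submodule.span ℂ (((Finset.univ.finsuppAntidiag d).image
      fun m : Fin (n + 1) →₀ ℕ => monomial m (1 : ℂ) : Finset (CoordRing n)) :
        Set (CoordRing n)) := by
  classical
  intro F hF
  rw [F.as_sum]
  refine Submodule.sum_mem _ fun m hm => ?_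
  rw [← mul_one (coeff m F), ← smul_eq_mul, ← smul_monomial]
  refine Submodule.smul_mem _ _ (Submodule.subset_span ?_)
  rw [Finset.coe_image]
  refine ⟨m, ?_, rfl⟩
  have h : m.degree = d := by
    rw [Finsupp.degree_eq_weight_one]
    exact hF (mem_support_iff.1 hm)
  simpa [Finsupp.degree_eq_sum] using h

theorem finrank_forms_le (n d : ℕ) : Module.finrank ℂ (Forms n d) ≤ (n + d).choose d := by
  classical
  refine (Submodule.finrank_mono (homogeneousSubmodule_le_span n d)).trans
    ((finrank_span_finset_le_card _).trans (Finset.card_image_le.trans ?_))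
  rw [Finset.card_finsuppAntidiag_nat_eq_choose, Finset.card_univ, Fintype.card_fin]
  exact le_of_eq (congrArg (fun k => Nat.choose k d) (by omega))

instance finite_forms (n d : ℕ) : Module.Finite ℂ (Forms n d) :=
  Module.Finite.iff_fg.2 (homogeneousSubmodule_fg _ _ d)

variable (A : (Fin 5 → ℂ) ≃ₗ[ℂ] (Fin 5 → ℂ))

/-- The restriction of quartic forms to the affine part of the curve `quarticCurve A`. -/
noncomputable def restrictToCurve : Forms 4 4 →ₗ[ℂ] Polynomial ℂ :=
  (aeval fun i => momentPoly fun j => A (Pi.single j 1) i : CoordRing 4 →ₐ[ℂ] _).toLinearMap ∘ₗ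
    (Forms 4 4).subtype

theorem eval_restrictToCurve (F : Forms 4 4) (t : ℂ) :
    (restrictToCurve A F).eval t = eval (A (moment ![1, t])) (F : CoordRing 4) := by
  have h : ((Polynomial.aeval t).comp (aeval fun i => momentPoly fun j => A (Pi.single j 1) i) :
      CoordRing 4 →ₐ[ℂ] ℂ) = aeval (A (moment ![1, t])) := by
    refine algHom_ext fun i => ?_
    rw [AlgHom.comp_apply, aeval_X, aeval_X, moment_affine]
    conv_rhs => rw [pi_eq_sum_univ' ![1, t, t ^ 2, t ^ 3, t ^ 4]]
    simp [momentPoly, Fin.sum_univ_succ]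
    ring
  exact congrArg (fun f : CoordRing 4 →ₐ[ℂ] ℂ => f F) h

/-- All the monomials `Tᵏ` with `k < 16` are restrictions of quartic forms. -/
theorem sixteen_le_finrank_range_restrictToCurve :
    16 ≤ Module.finrank ℂ (LinearMap.range (restrictToCurve A)) := by
  have hmem : ∀ k : Fin 16, (Polynomial.X ^ (k : ℕ) : Polynomial ℂ) ∈
      LinearMap.range (restrictToCurve A) := by
    intro k
    have hk := k.2
    let e : Fin 5 := ⟨k % 4, by omega⟩
    let F : CoordRing 4 := X 4 ^ ((k : ℕ) / 4) * X e * X 0 ^ (3 - (k : ℕ) / 4)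
    have hF : F.IsHomogeneous 4 := by
      have h := (((isHomogeneous_X ℂ (4 : Fin 5)).pow ((k : ℕ) / 4)).mul
        (isHomogeneous_X ℂ e)).mul ((isHomogeneous_X ℂ (0 : Fin 5)).pow (3 - (k : ℕ) / 4))
      convert h using 1
      omega
    refine ⟨⟨linSubst A.symm F, linSubst_isHomogeneous _ hF⟩, Polynomial.funext fun t => ?_⟩
    rw [eval_restrictToCurve, eval_linSubst]
    have he : moment ![1, t] e = t ^ ((k : ℕ) % 4) := by simp [moment, e]
    have h4 : moment ![1, t] 4 = t ^ 4 := by simp [moment]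
    have h0 : moment ![1, t] 0 = 1 := by simp [moment]
    simp only [LinearEquiv.coe_coe, LinearEquiv.symm_apply_apply, F, map_mul, map_pow, eval_X, he,
      h4, h0, one_pow, mul_one, Polynomial.eval_pow, Polynomial.eval_X]
    rw [← pow_mul, ← pow_add, Nat.div_add_mod]
  have hli : LinearIndependent ℂ fun k : Fin 16 =>
      (⟨_, hmem k⟩ : LinearMap.range (restrictToCurve A)) := by
    refine LinearIndependent.of_comp (LinearMap.range (restrictToCurve A)).subtype ?_
    have h := (Polynomial.basisMonomials ℂ).linearIndependent.comp
      (fun k : Fin 16 => (k : ℕ)) Fin.val_injective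
    convert h using 1
    funext k
    simp [Polynomial.X_pow_eq_monomial]
  simpa using hli.fintype_card_le_finrank

/-- The secant variety is singular along the curve, so the partial derivatives of its equation
vanish there. -/
theorem range_ruppertMap_le_ker :
    LinearMap.range (ruppertMap 2 (quarticCubic A)) ≤ LinearMap.ker (restrictToCurve A) := by
  rintro _ ⟨g, rfl⟩
  refine LinearMap.mem_ker.2 (Polynomial.funext fun t => ?_)
  rw [eval_restrictToCurve, Polynomial.eval_zero]
  change eval _ (∑ i, (g : Fin 5 → CoordRing 4) i * pderiv i (quarticCubic A : CoordRing 4)) = 0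
  rw [map_sum]
  refine Finset.sum_eq_zero fun i _ => ?_
  have h : gradDot (quarticCubic A : CoordRing 4) (A (moment ![1, t])) (Pi.single i 1) = 0 := by
    refine (gradDot_linSubst A.symm.toLinearMap hankelCubic _ _).trans ?_
    simp only [LinearEquiv.coe_coe, LinearEquiv.symm_apply_apply]
    exact gradDot_hankelCubic_moment _ _
  have h' : eval (A (moment ![1, t])) (pderiv i (quarticCubic A : CoordRing 4)) = 0 := by
    rw [← h, gradDot, Finset.sum_eq_single i]
    · simp [aeval_eq_eval]
    · intro j _ hj
      simp [hj]
    · simp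
  rw [map_mul, h', mul_zero]

theorem finrank_range_ruppertMap_quarticCubic_le :
    Module.finrank ℂ (LinearMap.range (ruppertMap 2 (quarticCubic A))) ≤ 59 := by
  refine (Submodule.finrank_mono (range_ruppertMap_le_ker A)).trans
    (?_ : Module.finrank ℂ (LinearMap.ker (restrictToCurve A)) ≤ 59)
  have h2 := LinearMap.finrank_range_add_finrank_ker (restrictToCurve A)
  have h3 : Module.finrank ℂ (Forms 4 4) ≤ 70 := finrank_forms_le 4 4
  have h4 := sixteen_le_finrank_range_restrictToCurve A
  omega

/-- A nonzero minor of size `k` makes the images of `k` basis vectors linearly independent. -/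
theorem minorsVanish_of_finrank_range_lt {M N : Type} [AddCommGroup M] [Module ℂ M]
    [AddCommGroup N] [Module ℂ N] [Module.Finite ℂ N] {k : ℕ} {φ : M →ₗ[ℂ] N}
    (h : Module.finrank ℂ (LinearMap.range φ) < k) : MinorsVanish k φ := by
  intro ι κ _ _ _ _ b c rows cols
  by_contra hdet
  have hli : LinearIndependent ℂ fun j : Fin k =>
      (⟨φ (b (cols j)), LinearMap.mem_range_self _ _⟩ : LinearMap.range φ) := by
    refine LinearIndependent.of_comp (LinearMap.range φ).subtype
      (Fintype.linearIndependent_iff.2 fun a ha => ?_)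
    refine congrFun (Matrix.eq_zero_of_mulVec_eq_zero hdet (v := a) (funext fun i => ?_))
    have hi := congrArg (fun v => c.repr v (rows i)) ha
    simpa [Matrix.mulVec, dotProduct, LinearMap.toMatrix_apply, mul_comm] using hi
  have := hli.fintype_card_le_finrank
  rw [Fintype.card_fin] at this
  omega

end Rank

theorem mainTheorem9 :
    (∀ (n : ℕ), 4 ≤ n → ∀ C : Set (CP n), IsSmoothIrreducibleCurve C → IsNondegenerate C →
      ¬ ∃ P : Submodule ℂ (Fin (n + 1) → ℂ),
        Module.finrank ℂ P = 3 ∧ linearSpace P ⊆ secantVariety 2 C) ∧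
    (∀ C : Set (CP 4), IsRationalNormalCurve C →
      ∃ f : Forms 4 3,
        projZeroLocus {(f : CoordRing 4)} = secantVariety 2 C ∧
        (∀ g : Forms 4 3, projZeroLocus {(g : CoordRing 4)} = secantVariety 2 C →
          ∃ a : ℂ, a ≠ 0 ∧ g = a • f) ∧
        3 ≤ sliceRank f ∧
        Module.finrank ℂ (LinearMap.range (ruppertMap 2 f)) ≤ 59 ∧
        MinorsVanish 60 (ruppertMap 2 f)) := by
  refine ⟨fun n hn C hC hnd ⟨P, hP, hsub⟩ =>
    not_linearSpace_subset_secantVariety hn hC hnd hP hsub, ?_⟩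
  rintro _ ⟨A, rfl⟩
  have hrank := finrank_range_ruppertMap_quarticCubic_le A
  refine ⟨quarticCubic A, projZeroLocus_quarticCubic A, fun g hg => ?_,
    three_le_sliceRank_quarticCubic A, hrank,
    minorsVanish_of_finrank_range_lt (Nat.lt_succ_of_le hrank)⟩
  exact exists_eq_smul_of_projZeroLocus_eq (irreducible_quarticCubic A)
    (hg.trans (projZeroLocus_quarticCubic A).symm) three_ne_zero
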